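/- Theorem (FEI). There exists a universal constant $C>0$ with the following property. Let $I$ be an at most countable set, let $\mathcal H$ be a separable complex Hilbert space, let $\varepsilon>0$, and let $\{u_i\}_{i\in I}\subset\mathcal H$ be a Bessel sequence with bound $1$, that is, $$\sum_{i\in I}|\langle x,u_i\rangle|^2\le \|x\|^2\qquad\text{for all }x\in\mathcal H,$$ such that $\|u_i\|^2\ge\varepsilon$ for all $i\in I$. Then $I$ can be partitioned into $r\le C/\varepsilon$ pairwise disjoint (possibly empty) subsets $I_1,\dots,I_r$ such that for each $j=1,\dots,r$ the subfamily $\{u_i\}_{i\in I_j}$ is a Riesz sequence; that is, there are constants $A,B>0$ (a priori depending on $j$) such that for every $\{a_i\}_{i\in I_j}\in\ell^2(I_j)$ the series $\sum_{i\in I_j}a_iu_i$ converges unconditionally in $\mathcal H$ and $$A\sum_{i\in I_j}|a_i|^2\le\Big\|\sum_{i\in I_j}a_iu_i\Big\|^2\le B\sum_{i\in I_j}|a_i|^2 .$$ (If $I=\emptyset$, $r=0$ is allowed.) -/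

import Mathlib

/-- The family `u` in `H` is a Bessel sequence with Bessel bound `B`:
`∑ i, |⟨x, u i⟩|² ≤ B ‖x‖²` for all `x`, where the convergence of the series is part of the claim. -/
def IsBesselSequence {ι H : Type*} [NormedAddCommGroup H] [InnerProductSpace ℂ H]
    (u : ι → H) (B : ℝ) : Prop :=
  ∀ x : H, Summable (fun i => ‖inner ℂ x (u i)‖ ^ 2) ∧
    ∑' i, ‖inner ℂ x (u i)‖ ^ 2 ≤ B * ‖x‖ ^ 2

/-- The family `u` in `H` satisfies the Riesz inequalities with lower bound `A` and upper bound `B`: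
for every square summable `a`, the series `∑ i, a i • u i` converges (unconditionally) and
`A ∑ |a i|² ≤ ‖∑ a i • u i‖² ≤ B ∑ |a i|²`. -/
def HasRieszBounds {ι H : Type*} [NormedAddCommGroup H] [InnerProductSpace ℂ H]
    (u : ι → H) (A B : ℝ) : Prop :=
  ∀ a : ι → ℂ, Summable (fun i => ‖a i‖ ^ 2) →
    Summable (fun i => a i • u i) ∧
    A * ∑' i, ‖a i‖ ^ 2 ≤ ‖∑' i, a i • u i‖ ^ 2 ∧
    ‖∑' i, a i • u i‖ ^ 2 ≤ B * ∑' i, ‖a i‖ ^ 2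

/-- The family `u` is a Riesz sequence: it has some positive lower and upper Riesz bounds. -/
def IsRieszSequence {ι H : Type*} [NormedAddCommGroup H] [InnerProductSpace ℂ H]
    (u : ι → H) : Prop :=
  ∃ A B : ℝ, 0 < A ∧ 0 < B ∧ HasRieszBounds u A B

/-! For finitely many of the vectors, the Gram matrix satisfies `0 ≤ A ≤ 1` with diagonal at least
`ε`, and a lower Riesz bound on a colour class is a lower bound for the compression of `A` to that
class. The engine is a paving theorem, `exists_coloring_of_posSemidef`: small diagonal gives a
colouring with small compressions. Paving `1 - A` at once, with diagonal up to `1 - ε`, would cost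
about `1/ε²` colours. `exists_coloring_lower_bound` paves twice instead: after the diagonal is
scaled down to `ε`, about `1/ε` colours bring all blocks below `6ε`; dividing by `6ε` leaves
diagonal `1/6`, and paving the complement then costs an absolute number of colours. Since the number
of colours does not depend on the finite set, Rado selection yields one colouring of the whole index
set.

Paving follows from `exists_choice_sum_le`, the Marcus–Spielman–Srivastava theorem. The determinant
of `z₀ I + ∑ zₑ wₑ wₑ*` is stable, and affine in each `zₑ` because the summands have rank one; hence
`1 - ∂ₑ` acts as subtraction of `wₑ wₑ*`. Averaging over choices means using `1 - D_v` with an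
averaged direction `v`. The barrier `D_v f / f` is decreasing and convex above the roots, which
bounds the roots of the averaged polynomial (`IsAbove.subDerivs`). `IsAbove.exists_choice` then
replaces averaged operators by actual choices, one at a time, keeping the same bound. -/

namespace KadisonSinger

open Polynomial Filter Topology

/-! ### Rational functions mapping the upper half-plane to the closed lower one -/

section Univariate

theorem im_le_zero_of_tendsto {ψ : ℝ → ℂ} (hc : ContinuousAt ψ 0)
    (h : ∀ η : ℝ, 0 < η → (ψ η).im ≤ 0) : (ψ 0).im ≤ 0 := by
  have h1 : Tendsto (fun η => (ψ η).im) (𝓝[>] 0) (𝓝 (ψ 0).im) :=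
    (Complex.continuous_im.continuousAt.comp hc).tendsto.mono_left nhdsWithin_le_nhds
  exact le_of_tendsto h1 (by filter_upwards [self_mem_nhdsWithin] with η hη using h η hη)

/-- A complex number whose rotations by all `n`-th powers, `n ≥ 2`, of points of the upper half-plane
avoid the upper half-plane is zero. -/
theorem eq_zero_of_forall_im_mul_pow_le {n : ℕ} (hn : 2 ≤ n) {K : ℂ}
    (h : ∀ w : ℂ, 0 < w.im → (K * w ^ n).im ≤ 0) : K = 0 := by
  have hn0 : (0 : ℝ) < n := by positivity
  have hn2 : (2 : ℝ) ≤ n := by exact_mod_cast hn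
  set W : ℂ := Complex.exp (Real.pi / 4 * Complex.I) with hW
  -- The `n`-th power of `exp(iθ)` with `θ = (2k+1)π/(4n)` is `W * I ^ k`, and `θ ≤ 7π/8` since `n ≥
  -- 2`. The four quarter turns of `K * W` all avoid the upper half-plane, so `K * W = 0`.
  have key : ∀ k : ℕ, k ≤ 3 → (K * (W * Complex.I ^ k)).im ≤ 0 := by
    intro k hk
    have hk' : (k : ℝ) ≤ 3 := by exact_mod_cast hk
    set θ : ℝ := (2 * k + 1) * Real.pi / (4 * n) with hθ
    have hθ0 : 0 < θ := by positivity
    have hθ1 : θ < Real.pi := by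
      rw [hθ, div_lt_iff₀ (by positivity)]
      nlinarith [Real.pi_pos, mul_le_mul_of_nonneg_left hn2 Real.pi_pos.le]
    have hw : (Complex.exp (θ * Complex.I)).im = Real.sin θ := Complex.exp_ofReal_mul_I_im θ
    have := h (Complex.exp (θ * Complex.I)) (by rw [hw]; exact Real.sin_pos_of_pos_of_lt_pi hθ0 hθ1)
    rw [← Complex.exp_nat_mul] at this
    have e : Complex.exp (n * (θ * Complex.I)) = W * Complex.I ^ k := by
      rw [hW]
      have : Complex.I = Complex.exp (Real.pi / 2 * Complex.I) := by
        rw [Complex.exp_pi_div_two_mul_I]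
      conv_rhs => rw [show Complex.I ^ k = Complex.exp (Real.pi / 2 * Complex.I) ^ k by rw [← this]]
      rw [← Complex.exp_nat_mul, ← Complex.exp_add]
      congr 1
      have : (n : ℂ) ≠ 0 := by exact_mod_cast hn0.ne'
      rw [hθ]; push_cast
      field_simp
      ring
    rwa [e] at this
  have h0 := key 0 (by norm_num)
  have h1 := key 1 (by norm_num)
  have h2 := key 2 (by norm_num)
  have h3 := key 3 (by norm_num)
  have hKW : K * W = 0 := by
    rw [pow_zero, mul_one] at h0
    rw [pow_one, ← mul_assoc] at h1
    rw [Complex.I_sq, ← mul_assoc] at h2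
    rw [Complex.I_pow_three, ← mul_assoc] at h3
    simp only [Complex.mul_im, Complex.I_re, Complex.I_im, Complex.neg_re, Complex.neg_im,
      Complex.one_re, Complex.one_im] at h0 h1 h2 h3
    apply Complex.ext <;> simp only [Complex.mul_im, Complex.mul_re, Complex.zero_re,
      Complex.zero_im] at * <;> linarith
  exact (mul_eq_zero.1 hKW).resolve_right (Complex.exp_ne_zero _)

/-- The map `w ↦ -w⁻¹` preserves the upper half-plane and reduces poles to powers. -/
theorem eq_zero_of_forall_im_mul_inv_pow_le {n : ℕ} (hn : 2 ≤ n) {K : ℂ}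
    (h : ∀ w : ℂ, 0 < w.im → (K * (w ^ n)⁻¹).im ≤ 0) : K = 0 := by
  have := eq_zero_of_forall_im_mul_pow_le hn (K := K * (-1) ^ n) fun w hw => by
    have hw0 : w ≠ 0 := by rintro rfl; simp at hw
    have := h (-w⁻¹) (by
      rw [Complex.neg_im, Complex.inv_im, neg_div, neg_neg]
      exact div_pos hw (Complex.normSq_pos.2 hw0))
    have e : ((-w⁻¹) ^ n)⁻¹ = (-1) ^ n * w ^ n := by
      rw [← inv_pow, ← mul_pow, ← neg_inv, inv_inv]; ring
    rwa [e, ← mul_assoc] at this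
  simpa using this

/-- Partial fractions for a real rational function which maps the upper half-plane into the closed
lower half-plane. -/
theorem exists_partial_fractions {p q : ℝ[X]} (hp : ∀ z : ℂ, 0 < z.im → aeval z p ≠ 0)
    (hq : ∀ z : ℂ, 0 < z.im → (aeval z q / aeval z p).im ≤ 0) :
    ∃ (s : Finset ℝ) (c : ℝ → ℝ) (a b : ℝ), 0 ≤ b ∧ (∀ y ∈ s, 0 ≤ c y ∧ p.eval y = 0) ∧
      ∀ t : ℝ, p.eval t ≠ 0 → q.eval t / p.eval t = a - b * t + ∑ y ∈ s, c y / (t - y) := by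
  classical
  set P : ℂ[X] := p.map (algebraMap ℝ ℂ) with hP
  set Q : ℂ[X] := q.map (algebraMap ℝ ℂ) with hQ
  have evP : ∀ z, aeval z p = P.eval z := fun z => by rw [hP, eval_map_algebraMap]
  have evQ : ∀ z, aeval z q = Q.eval z := fun z => by rw [hQ, eval_map_algebraMap]
  have evPr : ∀ t : ℝ, P.eval (t : ℂ) = (p.eval t : ℝ) := fun t => by
    rw [← evP]; simpa using (aeval_algebraMap_apply ℂ t p)
  have evQr : ∀ t : ℝ, Q.eval (t : ℂ) = (q.eval t : ℝ) := fun t => by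
    rw [← evQ]; simpa using (aeval_algebraMap_apply ℂ t q)
  have hP0 : P ≠ 0 := by
    intro h; apply hp Complex.I (by simp); rw [evP, h, eval_zero]
  obtain ⟨P1, hP1⟩ := EuclideanDomain.gcd_dvd_left P Q
  obtain ⟨Q1, hQ1⟩ := EuclideanDomain.gcd_dvd_right P Q
  set g := EuclideanDomain.gcd P Q with hg
  have hg0 : g ≠ 0 := by rintro h; rw [h, zero_mul] at hP1; exact hP0 hP1
  have hP10 : P1 ≠ 0 := by rintro h; rw [h, mul_zero] at hP1; exact hP0 hP1
  have hcop : IsCoprime P1 Q1 := by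
    refine ⟨EuclideanDomain.gcdA P Q, EuclideanDomain.gcdB P Q, mul_left_cancel₀ hg0 ?_⟩
    calc g * (EuclideanDomain.gcdA P Q * P1 + EuclideanDomain.gcdB P Q * Q1)
        = (g * P1) * EuclideanDomain.gcdA P Q + (g * Q1) * EuclideanDomain.gcdB P Q := by ring
      _ = g * 1 := by rw [← hP1, ← hQ1, mul_one, hg]; exact (EuclideanDomain.gcd_eq_gcd_ab P Q).symm
  have hP1z : ∀ z : ℂ, P1.eval z = 0 → P.eval z = 0 := fun z h => by rw [hP1, eval_mul, h, mul_zero]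
  have hφ : ∀ z : ℂ, P.eval z ≠ 0 → Q.eval z / P.eval z = Q1.eval z / P1.eval z := fun z hz => by
    have : g.eval z ≠ 0 := by
      intro h; apply hz; rw [hP1, eval_mul, h, zero_mul]
    conv_lhs => rw [hP1, hQ1, eval_mul, eval_mul, mul_div_mul_left _ _ this]
  have him : ∀ z : ℂ, 0 < z.im → (Q1.eval z / P1.eval z).im ≤ 0 := fun z hz => by
    rw [← hφ z (by rw [← evP]; exact hp z hz), ← evP, ← evQ]; exact hq z hz
  have hP1u : ∀ z : ℂ, 0 < z.im → P1.eval z ≠ 0 := fun z hz h =>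
    hp z hz (by rw [evP]; exact hP1z z h)
  -- A root in the lower half-plane would give `p`, which has real coefficients, a conjugate root in
  -- the upper one.
  have hreal : ∀ z : ℂ, P1.eval z = 0 → ((z.re : ℝ) : ℂ) = z := by
    intro z hz
    have h1 : z.im ≤ 0 := by
      by_contra h; exact hP1u z (not_le.1 h) hz
    have h2 : 0 ≤ z.im := by
      by_contra h
      apply hp (starRingEnd ℂ z) (by simpa using h)
      rw [aeval_conj, evP, hP1z z hz, map_zero]
    exact Complex.ext (by simp) (by simp; linarith)
  -- The leading term at a pole of order `m` inherits the sign condition: put `z = y + η w`,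
  -- multiply by `η ^ m` and let `η → 0+`. This excludes `m ≥ 2` and, at `w = I`, makes the residues
  -- have nonnegative real part.
  have hlim : ∀ (y : ℝ) (m : ℕ) (R : ℂ[X]), P1 = (X - C (y : ℂ)) ^ m * R → R.eval (y : ℂ) ≠ 0 →
      ∀ w : ℂ, 0 < w.im → (Q1.eval (y : ℂ) / R.eval (y : ℂ) * (w ^ m)⁻¹).im ≤ 0 := by
    intro y m R hR hRy w hw
    have := im_le_zero_of_tendsto
      (ψ := fun η : ℝ => Q1.eval (y + η * w : ℂ) / R.eval (y + η * w : ℂ) * (w ^ m)⁻¹)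
      (by
        refine ContinuousAt.mul (ContinuousAt.div ?_ ?_ (by simpa using hRy)) continuousAt_const
        · exact Continuous.continuousAt (by fun_prop)
        · exact Continuous.continuousAt (by fun_prop))
      (fun η hη => by
        have hz : 0 < (y + η * w : ℂ).im := by simp; positivity
        have := him _ hz
        rw [hR] at this
        simp only [eval_mul, eval_pow, eval_sub, eval_X, eval_C, add_sub_cancel_left, mul_pow] at this
        have e : Q1.eval (y + η * w : ℂ) / ((η : ℂ) ^ m * w ^ m * R.eval (y + η * w : ℂ)) =
            ((η ^ m)⁻¹ : ℝ) * (Q1.eval (y + η * w : ℂ) / R.eval (y + η * w : ℂ) * (w ^ m)⁻¹) := by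
          push_cast
          rw [div_eq_mul_inv, mul_inv, mul_inv, div_eq_mul_inv]; ring
        rw [e, Complex.im_ofReal_mul] at this
        exact nonpos_of_mul_nonpos_right this (by positivity))
    simpa using this
  have hQ1z : ∀ z : ℂ, P1.eval z = 0 → Q1.eval z ≠ 0 := by
    intro z hz hz'
    obtain ⟨a, b, hab⟩ := hcop
    have := congrArg (eval z) hab
    simp [hz, hz'] at this
  have hsimple : P1.roots.Nodup := by
    rw [Multiset.nodup_iff_count_le_one]
    intro z
    rw [count_roots]
    by_contra hcon
    have hz : P1.eval z = 0 := by
      by_contra h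
      rw [rootMultiplicity_eq_zero h] at hcon; omega
    obtain ⟨R, hR, hRz⟩ := exists_eq_pow_rootMultiplicity_mul_and_not_dvd P1 hP10 z
    rw [dvd_iff_isRoot, IsRoot.def] at hRz
    rw [← hreal z hz] at hR hRz hcon
    have := eq_zero_of_forall_im_mul_inv_pow_le (by omega) (hlim z.re _ R hR hRz)
    rw [div_eq_zero_iff] at this
    refine this.elim (hQ1z _ ?_) hRz
    rw [hreal z hz, hz]
  set R : ℂ → ℂ[X] := fun y => P1 /ₘ (X - C y) with hRdef
  have hR : ∀ y, P1.eval y = 0 → P1 = (X - C y) * R y := fun y hy =>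
    (mul_divByMonic_eq_iff_isRoot.2 hy).symm
  have hRy : ∀ y, P1.eval y = 0 → (R y).eval y ≠ 0 := by
    intro y hy h
    have hd : (X - C y) ^ 2 ∣ P1 := by
      rw [hR y hy, pow_two]
      exact mul_dvd_mul_left _ (dvd_iff_isRoot.2 h)
    have h1 := (le_rootMultiplicity_iff hP10).2 hd
    have h2 := Multiset.nodup_iff_count_le_one.1 hsimple y
    rw [count_roots] at h2
    omega
  set K : ℂ → ℂ := fun y => Q1.eval y / (R y).eval y with hK
  set S : Finset ℂ := P1.roots.toFinset with hS
  have hSmem : ∀ y, y ∈ S ↔ P1.eval y = 0 := fun y => by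
    rw [hS, Multiset.mem_toFinset, mem_roots hP10, IsRoot.def]
  -- The numerator minus the polar parts vanishes at all roots of `P1`, which are simple.
  obtain ⟨h, hh⟩ : P1 ∣ Q1 - ∑ y ∈ S, C (K y) * R y := by
    set E := Q1 - ∑ y ∈ S, C (K y) * R y with hE
    by_cases hE0 : E = 0
    · rw [hE0]; exact dvd_zero _
    rw [Splits.dvd_iff_roots_le_roots (IsAlgClosed.splits P1) hP10 hE0,
      Multiset.le_iff_subset hsimple]
    intro y hy
    rw [mem_roots hE0, IsRoot.def]
    have hy0 : P1.eval y = 0 := by rwa [mem_roots hP10] at hy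
    rw [hE, eval_sub, eval_finsetSum, Finset.sum_eq_single y]
    · rw [eval_mul, eval_C, hK]; simp only; rw [div_mul_cancel₀ _ (hRy y hy0), sub_self]
    · intro x hx hxy
      have h1 := congrArg (eval y) (hR x ((hSmem x).1 hx))
      rw [hy0, eval_mul, eval_sub, eval_X, eval_C] at h1
      have : (R x).eval y = 0 :=
        (mul_eq_zero.1 h1.symm).resolve_left (sub_ne_zero.2 (Ne.symm hxy))
      rw [eval_mul, this, mul_zero]
    · intro h; exact absurd ((hSmem y).2 hy0) h
  have hrep : ∀ z, P1.eval z ≠ 0 →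
      Q1.eval z / P1.eval z = h.eval z + ∑ y ∈ S, K y / (z - y) := by
    intro z hz
    have hQe : Q1 = P1 * h + ∑ y ∈ S, C (K y) * R y := by rw [← hh]; ring
    rw [hQe, eval_add, eval_mul, add_div, mul_div_cancel_left₀ _ hz, eval_finsetSum,
      Finset.sum_div]
    congr 1
    refine Finset.sum_congr rfl fun y hy => ?_
    have hy0 := hR y ((hSmem y).1 hy)
    have h1 := congrArg (eval z) hy0
    rw [eval_mul, eval_sub, eval_X, eval_C] at h1
    rw [h1] at hz ⊢
    rw [eval_mul, eval_C]
    have hz1 := left_ne_zero_of_mul hz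
    have hz2 := right_ne_zero_of_mul hz
    field_simp
  have hKre : ∀ y ∈ S, 0 ≤ (K y).re := by
    intro y hy
    have hy0 := (hSmem y).1 hy
    have e := hreal y hy0
    have := hlim y.re 1 (R y) (by rw [pow_one, e]; exact hR y hy0) (by rw [e]; exact hRy y hy0)
      Complex.I (by simp)
    rw [e, pow_one, Complex.inv_I] at this
    simpa using this
  -- The same limit at infinity: `z = w / η`, scaled by `η ^ n`; reversing `h` makes its
  -- contribution polynomial in `η`. Hence the polynomial part has degree at most one.
  have hlead : ∀ w : ℂ, 0 < w.im → (h.leadingCoeff * w ^ h.natDegree).im ≤ 0 := by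
    intro w hw
    have hw0 : w ≠ 0 := by rintro rfl; simp at hw
    set n := h.natDegree
    have := im_le_zero_of_tendsto
      (ψ := fun η : ℝ => h.reverse.eval (η * w⁻¹ : ℂ) * w ^ n +
        ∑ y ∈ S, (η : ℂ) ^ (n + 1) * (K y / (w - η * y)))
      (by
        refine ContinuousAt.add (Continuous.continuousAt (by fun_prop))
          (tendsto_finsetSum _ fun y hy => ?_)
        refine ContinuousAt.mul (Continuous.continuousAt (by fun_prop))
          (ContinuousAt.div continuousAt_const (Continuous.continuousAt (by fun_prop)) ?_)
        simpa using hw0)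
      (fun η hη => by
        have hηc : (η : ℂ) ≠ 0 := by exact_mod_cast hη.ne'
        have hz : 0 < (w * (η⁻¹ : ℝ) : ℂ).im := by
          rw [Complex.im_mul_ofReal]; positivity
        have h1 := him _ hz
        rw [hrep _ (hP1u _ hz)] at h1
        have hz0 : (w * (η⁻¹ : ℝ) : ℂ) ≠ 0 := by rintro h; rw [h] at hz; simp at hz
        let _ := invertibleOfNonzero hz0
        have h2 := eval₂_reverse_mul_pow (RingHom.id ℂ) (w * (η⁻¹ : ℝ) : ℂ) h
        rw [invOf_eq_inv, eval₂_id, eval₂_id] at h2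
        have e : h.reverse.eval (η * w⁻¹ : ℂ) * w ^ n +
            ∑ y ∈ S, (η : ℂ) ^ (n + 1) * (K y / (w - η * y)) =
            ((η ^ n : ℝ) : ℂ) * (h.eval (w * (η⁻¹ : ℝ) : ℂ) +
              ∑ y ∈ S, K y / ((w * (η⁻¹ : ℝ) : ℂ) - y)) := by
          rw [← h2, mul_add, Finset.mul_sum]
          congr 1
          · have hηn : (η : ℂ) ^ n ≠ 0 := pow_ne_zero _ hηc
            rw [Complex.ofReal_inv, mul_inv, inv_inv, mul_comm w⁻¹, mul_pow, inv_pow,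
              Complex.ofReal_pow]
            change _ = _ * (_ * (w ^ n * ((η : ℂ) ^ n)⁻¹))
            field_simp
          · refine Finset.sum_congr rfl fun y hy => ?_
            have : w * ((η⁻¹ : ℝ) : ℂ) - y = (w - η * y) / η := by
              push_cast; field_simp
            rw [this]; push_cast; rw [pow_succ, div_div_eq_mul_div]; ring
        rw [e, Complex.im_ofReal_mul]
        exact mul_nonpos_of_nonneg_of_nonpos (by positivity) h1)
    have e : h.reverse.eval 0 = h.leadingCoeff := by
      rw [← coeff_zero_eq_eval_zero, coeff_zero_reverse]
    simpa [e] using this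
  have hdeg : h.natDegree ≤ 1 := by
    by_contra hcon
    have h0 := eq_zero_of_forall_im_mul_pow_le (by omega) hlead
    rw [leadingCoeff_eq_zero] at h0
    rw [h0] at hcon; simp at hcon
  have hlin := eq_X_add_C_of_natDegree_le_one hdeg
  have hb : (h.coeff 1).re ≤ 0 := by
    rcases Nat.le_one_iff_eq_zero_or_eq_one.1 hdeg with h0 | h1
    · rw [coeff_eq_zero_of_natDegree_lt (by omega)]; simp
    · have := hlead Complex.I (by simp)
      rw [leadingCoeff, h1, pow_one] at this
      simpa using this
  have hinj : ∀ y ∈ S, ∀ z ∈ S, y.re = z.re → y = z := fun y hy z hz e => by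
    rw [← hreal y ((hSmem y).1 hy), ← hreal z ((hSmem z).1 hz), e]
  -- Taking real parts of the coefficients suffices: the poles, `t` and the value of the function
  -- are real.
  refine ⟨S.image Complex.re, fun y => (K y).re, (h.coeff 0).re, -(h.coeff 1).re, by linarith,
    ?_, ?_⟩
  · intro y hy
    obtain ⟨z, hz, rfl⟩ := Finset.mem_image.1 hy
    have hz0 := (hSmem z).1 hz
    refine ⟨by simpa only [hreal z hz0] using hKre z hz, ?_⟩
    have := evPr z.re
    rw [hreal z hz0, hP1z z hz0] at this
    exact_mod_cast this.symm
  · intro t ht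
    have htP : P.eval (t : ℂ) ≠ 0 := by rw [evPr]; exact_mod_cast ht
    have ht1 : P1.eval (t : ℂ) ≠ 0 := fun h0 => htP (hP1z _ h0)
    have h1 := (hφ t htP).trans (hrep t ht1)
    rw [evPr, evQr, ← Complex.ofReal_div] at h1
    have h2 := congrArg Complex.re h1
    rw [Complex.ofReal_re, Complex.add_re, Complex.re_sum, hlin] at h2
    rw [h2, Finset.sum_image hinj]
    congr 1
    · simp; ring
    · refine Finset.sum_congr rfl fun y hy => ?_
      have e := hreal y ((hSmem y).1 hy)
      have e2 : (t : ℂ) - y = ((t - y.re : ℝ) : ℂ) := by rw [Complex.ofReal_sub, e]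
      simp only [e]
      rw [e2, Complex.div_ofReal_re]

/-- Monotonicity and convexity of a real rational function which maps the upper half-plane into the
closed lower half-plane, to the right of its poles. -/
theorem antitone_and_convex_of_im_nonpos {p q : ℝ[X]} (hp : ∀ z : ℂ, 0 < z.im → aeval z p ≠ 0)
    (hq : ∀ z : ℂ, 0 < z.im → (aeval z q / aeval z p).im ≤ 0) (h0 : ∀ t : ℝ, 0 ≤ t → p.eval t ≠ 0)
    {δ : ℝ} (hδ : 0 ≤ δ) :
    q.eval δ / p.eval δ ≤ q.eval 0 / p.eval 0 ∧
    ((derivative q).eval δ * p.eval δ - q.eval δ * (derivative p).eval δ) / p.eval δ ^ 2 ≤ 0 ∧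
    -δ * (((derivative q).eval δ * p.eval δ - q.eval δ * (derivative p).eval δ) / p.eval δ ^ 2) ≤
      q.eval 0 / p.eval 0 - q.eval δ / p.eval δ := by
  obtain ⟨s, c, a, b, hb, hs, hrep⟩ := exists_partial_fractions hp hq
  have hy : ∀ y ∈ s, y < 0 := fun y hy => by
    by_contra h; exact h0 y (not_lt.1 h) (hs y hy).2
  have hd1 : HasDerivAt (fun t => q.eval t / p.eval t)
      (((derivative q).eval δ * p.eval δ - q.eval δ * (derivative p).eval δ) / p.eval δ ^ 2) δ :=
    (q.hasDerivAt δ).div (p.hasDerivAt δ) (h0 δ hδ)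
  have hd2 : HasDerivAt (fun t => a - b * t + ∑ y ∈ s, c y / (t - y))
      (-b + ∑ y ∈ s, -(c y / (δ - y) ^ 2)) δ := by
    refine HasDerivAt.add ?_ (HasDerivAt.fun_sum fun y hys => ?_)
    · simpa using ((hasDerivAt_id δ).const_mul b).const_sub a
    · have : δ - y ≠ 0 := by have := hy y hys; linarith
      have h := ((hasDerivAt_id δ).sub_const y).inv this |>.const_mul (c y)
      simp only [id] at h
      convert! h using 1; ring
  have hev : (fun t => q.eval t / p.eval t) =ᶠ[𝓝 δ] fun t => a - b * t + ∑ y ∈ s, c y / (t - y) := by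
    have : ∀ᶠ t in 𝓝 δ, p.eval t ≠ 0 := p.continuous.continuousAt.eventually_ne (h0 δ hδ)
    filter_upwards [this] with t ht using hrep t ht
  rw [hd1.unique (hd2.congr_of_eventuallyEq hev), hrep δ (h0 δ hδ), hrep 0 (h0 0 le_rfl)]
  have hterm : ∀ y ∈ s, 0 ≤ c y / (δ - y) ^ 2 ∧
      δ * (c y / (δ - y) ^ 2) ≤ c y / (0 - y) - c y / (δ - y) := by
    intro y hys
    have h1 := hy y hys
    have h2 := (hs y hys).1
    have h3 : 0 < δ - y := by linarith
    have h4 : 0 < 0 - y := by linarith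
    refine ⟨by positivity, ?_⟩
    have : c y / (0 - y) - c y / (δ - y) - δ * (c y / (δ - y) ^ 2) =
        c y * δ ^ 2 / ((0 - y) * (δ - y) ^ 2) := by
      field_simp; ring
    have h5 : 0 ≤ c y * δ ^ 2 / ((0 - y) * (δ - y) ^ 2) := by positivity
    linarith
  have hsum1 : 0 ≤ ∑ y ∈ s, c y / (δ - y) ^ 2 := Finset.sum_nonneg fun y hys => (hterm y hys).1
  have hsum2 : δ * ∑ y ∈ s, c y / (δ - y) ^ 2 ≤
      ∑ y ∈ s, c y / (0 - y) - ∑ y ∈ s, c y / (δ - y) := by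
    rw [Finset.mul_sum, ← Finset.sum_sub_distrib]
    exact Finset.sum_le_sum fun y hys => (hterm y hys).2
  rw [Finset.sum_neg_distrib]
  refine ⟨?_, by linarith, ?_⟩
  · nlinarith [mul_nonneg hδ hsum1, mul_nonneg hb hδ]
  · nlinarith [mul_nonneg hδ hsum1, mul_nonneg hb hδ]

end Univariate

end KadisonSinger

namespace KadisonSinger

open Filter Topology MvPolynomial

/-! ### Stable polynomials and the barrier method -/

section Stability

variable {τ : Type*}

/-- The derivative of a polynomial in the direction `v`. -/
noncomputable def dirDeriv (v : τ → ℝ) :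
    Derivation ℝ (MvPolynomial τ ℝ) (MvPolynomial τ ℝ) :=
  mkDerivation ℝ fun i => C (v i)

/-- The operator `1 - D_v`. -/
noncomputable def subDeriv (v : τ → ℝ) (f : MvPolynomial τ ℝ) : MvPolynomial τ ℝ :=
  f - dirDeriv v f

/-- The restriction of a polynomial to the line `t ↦ a + t v`. -/
noncomputable def line {K : Type*} [Field K] [Algebra ℝ K] (a : τ → K) (v : τ → ℝ) :
    MvPolynomial τ ℝ →ₐ[ℝ] Polynomial K :=
  aeval fun i => Polynomial.C (a i) + Polynomial.C (algebraMap ℝ K (v i)) * Polynomial.X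

theorem dirDeriv_X (v : τ → ℝ) (i : τ) : dirDeriv v (X i) = C (v i) :=
  mkDerivation_X _ _ _

theorem dirDeriv_add (u v : τ → ℝ) (f : MvPolynomial τ ℝ) :
    dirDeriv (u + v) f = dirDeriv u f + dirDeriv v f := by
  have : dirDeriv (u + v) = dirDeriv u + dirDeriv v :=
    derivation_ext fun i => by simp [dirDeriv_X]
  rw [this]; rfl

theorem dirDeriv_smul (c : ℝ) (v : τ → ℝ) (f : MvPolynomial τ ℝ) :
    dirDeriv (c • v) f = c • dirDeriv v f := by
  have : dirDeriv (c • v) = c • dirDeriv v :=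
    derivation_ext fun i => by simp [dirDeriv_X, smul_eq_C_mul]
  rw [this]; rfl

theorem dirDeriv_zero (f : MvPolynomial τ ℝ) : dirDeriv 0 f = 0 := by
  have := dirDeriv_smul 0 (0 : τ → ℝ) f
  simpa using this

theorem dirDeriv_sum {κ : Type*} (s : Finset κ) (v : κ → τ → ℝ) (f : MvPolynomial τ ℝ) :
    dirDeriv (∑ j ∈ s, v j) f = ∑ j ∈ s, dirDeriv (v j) f := by
  classical
  induction s using Finset.induction_on with
  | empty => simp [dirDeriv_zero]
  | insert j s hj ih => rw [Finset.sum_insert hj, Finset.sum_insert hj, dirDeriv_add, ih]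

theorem dirDeriv_comm (u v : τ → ℝ) (f : MvPolynomial τ ℝ) :
    dirDeriv u (dirDeriv v f) = dirDeriv v (dirDeriv u f) := by
  have : ⁅dirDeriv u, dirDeriv v⁆ = 0 :=
    derivation_ext fun i => by
      rw [Derivation.commutator_apply]; simp [dirDeriv_X]
  have h := congrArg (fun D => D f) this
  simp only [Derivation.commutator_apply, Derivation.zero_apply] at h
  exact sub_eq_zero.1 h

theorem subDeriv_comm (u v : τ → ℝ) (f : MvPolynomial τ ℝ) :
    subDeriv u (subDeriv v f) = subDeriv v (subDeriv u f) := by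
  simp only [subDeriv, map_sub, dirDeriv_comm u v]; ring

theorem aeval_line {K L : Type*} [Field K] [Algebra ℝ K] [Field L] [Algebra ℝ L] [Algebra K L]
    [IsScalarTower ℝ K L] (a : τ → K) (v : τ → ℝ) (f : MvPolynomial τ ℝ) (z : L) :
    Polynomial.aeval z (line a v f) =
      aeval (fun i => algebraMap K L (a i) + algebraMap ℝ L (v i) * z) f := by
  induction f using MvPolynomial.induction_on with
  | C r => simp [line, Polynomial.algebraMap_apply, ← IsScalarTower.algebraMap_apply ℝ K L]
  | add p q hp hq => simp only [map_add, hp, hq]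
  | mul_X p i hp =>
    simp only [map_mul, hp]
    congr 1
    simp [line, ← IsScalarTower.algebraMap_apply ℝ K L]

theorem eval_line_complex (a : τ → ℂ) (v : τ → ℝ) (f : MvPolynomial τ ℝ) (z : ℂ) :
    (line a v f).eval z = aeval (fun i => a i + v i * z) f := by
  simpa [Polynomial.coe_aeval_eq_eval] using aeval_line (L := ℂ) a v f z

theorem eval_line (a : τ → ℝ) (v : τ → ℝ) (f : MvPolynomial τ ℝ) (t : ℝ) :
    (line a v f).eval t = eval (a + t • v) f := by
  have := aeval_line (L := ℝ) a v f t
  rw [Polynomial.coe_aeval_eq_eval] at this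
  rw [this, ← MvPolynomial.aeval_eq_eval]
  congr 2
  ext i; simp [mul_comm]

theorem derivative_line {K : Type*} [Field K] [Algebra ℝ K] (a : τ → K) (v : τ → ℝ)
    (f : MvPolynomial τ ℝ) :
    Polynomial.derivative (line a v f) = line a v (dirDeriv v f) := by
  induction f using MvPolynomial.induction_on with
  | C r => simp [line, Polynomial.algebraMap_apply, dirDeriv]
  | add p q hp hq => simp only [map_add, hp, hq]
  | mul_X p i hp =>
    rw [map_mul, Polynomial.derivative_mul, hp, Derivation.leibniz, map_add, smul_eq_mul,
      smul_eq_mul, map_mul, map_mul, dirDeriv_X]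
    have h1 : line a v (X i) =
        Polynomial.C (a i) + Polynomial.C (algebraMap ℝ K (v i)) * Polynomial.X := by simp [line]
    have h2 : line a v (C (v i)) = Polynomial.C (algebraMap ℝ K (v i)) := by
      simp [line, Polynomial.algebraMap_apply]
    rw [h1, h2]
    simp
    ring

theorem hasDerivAt_eval_line (a v : τ → ℝ) (f : MvPolynomial τ ℝ) :
    HasDerivAt (fun t : ℝ => eval (a + t • v) f) (eval a (dirDeriv v f)) 0 := by
  have := (line a v f).hasDerivAt 0
  rw [derivative_line, eval_line, zero_smul, add_zero] at this
  simpa only [eval_line] using this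

/-- Nonvanishing of `f` at points with imaginary parts nonnegative, and positive at `o`. -/
def IsStable (o : τ) (f : MvPolynomial τ ℝ) : Prop :=
  ∀ z : τ → ℂ, 0 < (z o).im → (∀ i, 0 ≤ (z i).im) → aeval z f ≠ 0

/-- The point `a` lies above the roots of `f`. -/
def IsAbove (f : MvPolynomial τ ℝ) (a : τ → ℝ) : Prop :=
  ∀ b, a ≤ b → 0 < eval b f

/-- The barrier function of `f` in the direction `v`. -/
noncomputable def barrier (v : τ → ℝ) (f : MvPolynomial τ ℝ) (a : τ → ℝ) : ℝ :=
  eval a (dirDeriv v f) / eval a f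

theorem IsAbove.mono {f : MvPolynomial τ ℝ} {a b : τ → ℝ} (h : IsAbove f a) (hab : a ≤ b) :
    IsAbove f b := fun c hc => h c (hab.trans hc)

theorem IsAbove.pos {f : MvPolynomial τ ℝ} {a : τ → ℝ} (h : IsAbove f a) : 0 < eval a f :=
  h a le_rfl

/-- The logarithmic derivative at `0` is the sum of `1 / (0 - r)` over the roots; each `r` lies in
the open lower half-plane, so each term has negative imaginary part. The value `0` occurs only for
the empty sum. -/
theorem logDeriv_eval_zero {p : Polynomial ℂ} (hp : ∀ s : ℂ, 0 ≤ s.im → p.eval s ≠ 0) :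
    p.derivative.eval 0 / p.eval 0 = 0 ∨ (p.derivative.eval 0 / p.eval 0).im < 0 := by
  rw [(IsAlgClosed.splits p).eval_derivative_div_eval_of_ne_zero (hp 0 (by simp))]
  have hr : ∀ r ∈ p.roots, r.im < 0 := fun r hr => by
    by_contra h; exact hp r (not_lt.1 h) (Polynomial.isRoot_of_mem_roots hr)
  generalize p.roots = m at hr
  induction m using Multiset.induction_on with
  | empty => simp
  | cons r m ih =>
    right
    have h1 := hr r (Multiset.mem_cons_self r m)
    have h2 := ih fun s hs => hr s (Multiset.mem_cons_of_mem hs)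
    have hr0 : r ≠ 0 := by rintro rfl; simp at h1
    have h3 : (1 / (0 - r)).im < 0 := by
      rw [zero_sub, one_div, Complex.inv_im, Complex.normSq_neg, Complex.neg_im, neg_neg]
      exact div_neg_of_neg_of_pos h1 (Complex.normSq_pos.2 hr0)
    rw [Multiset.map_cons, Multiset.sum_cons, Complex.add_im]
    rcases h2 with h2 | h2
    · rw [h2]; simpa using h3
    · linarith

/-- The line `s ↦ z + s u` stays in the region of stability for `Im s ≥ 0`, which reduces the claim
to one variable. -/
theorem IsStable.dirDeriv_div {o : τ} {f : MvPolynomial τ ℝ} (hf : IsStable o f) {u : τ → ℝ}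
    (hu : 0 ≤ u) {z : τ → ℂ} (hz : 0 < (z o).im) (hz' : ∀ i, 0 ≤ (z i).im) :
    aeval z (dirDeriv u f) / aeval z f = 0 ∨ (aeval z (dirDeriv u f) / aeval z f).im < 0 := by
  have h := logDeriv_eval_zero (p := line z u f) fun s hs => by
    rw [eval_line_complex]
    have him : ∀ i, (z i + u i * s).im = (z i).im + u i * s.im := fun i => by simp
    refine hf _ ?_ fun i => ?_
    · rw [him]; have := mul_nonneg (hu o) hs; linarith
    · rw [him]; exact add_nonneg (hz' i) (mul_nonneg (hu i) hs)
  rw [derivative_line, eval_line_complex, eval_line_complex] at h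
  simpa using h

/-- At a zero of `f - D_u f` the quotient `D_u f / f` would be `1`, which is neither `0` nor of
negative imaginary part. -/
theorem IsStable.subDeriv {o : τ} {f : MvPolynomial τ ℝ} (hf : IsStable o f) {u : τ → ℝ}
    (hu : 0 ≤ u) : IsStable o (subDeriv u f) := by
  intro z hz hz' h
  rw [KadisonSinger.subDeriv, map_sub, sub_eq_zero] at h
  have h1 := hf.dirDeriv_div hu hz hz'
  rw [← h, div_self (hf z hz hz')] at h1
  simp at h1

/-- Along `t ↦ a + t v` the barrier is a rational function of the kind treated above; the last
inequality is the tangent line inequality of convexity. Only nonvanishing on the ray is required, so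
this applies before `f` is known to be positive above `a`. -/
theorem IsStable.barrier_of_pos {o : τ} {f : MvPolynomial τ ℝ} (hf : IsStable o f) {u v : τ → ℝ}
    (hu : 0 ≤ u) (hv : 0 ≤ v) (hvo : 0 < v o) {a : τ → ℝ}
    (ha : ∀ t : ℝ, 0 ≤ t → eval (a + t • v) f ≠ 0) {δ : ℝ} (hδ : 0 ≤ δ) :
    barrier u f (a + δ • v) ≤ barrier u f a ∧
    (eval (a + δ • v) (dirDeriv v (dirDeriv u f)) * eval (a + δ • v) f -
      eval (a + δ • v) (dirDeriv u f) * eval (a + δ • v) (dirDeriv v f)) /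
        eval (a + δ • v) f ^ 2 ≤ 0 ∧
    -δ * ((eval (a + δ • v) (dirDeriv v (dirDeriv u f)) * eval (a + δ • v) f -
      eval (a + δ • v) (dirDeriv u f) * eval (a + δ • v) (dirDeriv v f)) /
        eval (a + δ • v) f ^ 2) ≤ barrier u f a - barrier u f (a + δ • v) := by
  have him : ∀ z : ℂ, 0 < z.im → 0 < (((a o : ℝ) : ℂ) + v o * z).im ∧
      ∀ i, 0 ≤ (((a i : ℝ) : ℂ) + v i * z).im := fun z hz => by
    have : ∀ i, (((a i : ℝ) : ℂ) + v i * z).im = v i * z.im := fun i => by simp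
    exact ⟨by rw [this]; positivity, fun i => by rw [this]; exact mul_nonneg (hv i) hz.le⟩
  have hev : ∀ (z : ℂ) (g : MvPolynomial τ ℝ), Polynomial.aeval z (line a v g) =
      aeval (fun i => ((a i : ℝ) : ℂ) + v i * z) g := fun z g => aeval_line a v g z
  have h := antitone_and_convex_of_im_nonpos (p := line a v f) (q := line a v (dirDeriv u f))
    (fun z hz => by rw [hev]; exact hf _ (him z hz).1 (him z hz).2)
    (fun z hz => by
      rw [hev, hev]
      rcases hf.dirDeriv_div hu (him z hz).1 (him z hz).2 with h | h
      · rw [h]; simp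
      · exact h.le)
    (fun t ht => by rw [eval_line]; exact ha t ht) hδ
  simp only [derivative_line, eval_line, zero_smul, add_zero] at h
  exact h

theorem le_of_continuousAt_zero {f g : ℝ → ℝ} (hf : ContinuousAt f 0) (hg : ContinuousAt g 0)
    (h : ∀ η, 0 < η → η < 1 → f η ≤ g η) : f 0 ≤ g 0 :=
  le_of_tendsto_of_tendsto (hf.tendsto.mono_left (nhdsWithin_le_nhds (s := Set.Ioi 0)))
    (hg.tendsto.mono_left nhdsWithin_le_nhds)
    (by filter_upwards [Ioo_mem_nhdsGT zero_lt_one] with η hη using h η hη.1 hη.2)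

/-- A direction with `v o = 0` does not carry the upper half-plane into the region of stability. The
direction is perturbed to `v + η e`, with `e` the unit vector at `o`, and `η → 0+`. -/
theorem IsAbove.barrier_le_and_convex {o : τ} {f : MvPolynomial τ ℝ} (hf : IsStable o f)
    {a : τ → ℝ} (ha : IsAbove f a) {u v : τ → ℝ} (hu : 0 ≤ u) (hv : 0 ≤ v) {δ : ℝ} (hδ : 0 ≤ δ) :
    barrier u f (a + δ • v) ≤ barrier u f a ∧
    (eval (a + δ • v) (dirDeriv v (dirDeriv u f)) * eval (a + δ • v) f -
      eval (a + δ • v) (dirDeriv u f) * eval (a + δ • v) (dirDeriv v f)) /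
        eval (a + δ • v) f ^ 2 ≤ 0 ∧
    -δ * ((eval (a + δ • v) (dirDeriv v (dirDeriv u f)) * eval (a + δ • v) f -
      eval (a + δ • v) (dirDeriv u f) * eval (a + δ • v) (dirDeriv v f)) /
        eval (a + δ • v) f ^ 2) ≤ barrier u f a - barrier u f (a + δ • v) := by
  classical
  set e : τ → ℝ := Pi.single o 1 with he
  have he0 : 0 ≤ e := by rw [he]; exact Pi.single_nonneg.2 zero_le_one
  have hw : ∀ η : ℝ, 0 < η → 0 ≤ v + η • e := fun η hη => add_nonneg hv (smul_nonneg hη.le he0)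
  have hvo : ∀ η : ℝ, 0 < η → 0 < (v + η • e) o := fun η hη => by
    have := hv o; simp [he] at this ⊢; linarith
  have hpos : ∀ {w : τ → ℝ}, 0 ≤ w → ∀ t : ℝ, 0 ≤ t → 0 < eval (a + t • w) f := fun {w} hw t ht =>
    ha _ (le_add_of_nonneg_right (smul_nonneg ht hw))
  have key := fun (η : ℝ) (hη : 0 < η) => hf.barrier_of_pos hu (hw η hη) (hvo η hη) (a := a)
    (fun t ht => (hpos (hw η hη) t ht).ne') hδ
  have hc : ∀ g : MvPolynomial τ ℝ, Continuous fun η : ℝ => eval (a + δ • (v + η • e)) g :=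
    fun g => (MvPolynomial.continuous_eval g).comp (by fun_prop)
  have hne : eval (a + δ • (v + (0 : ℝ) • e)) f ≠ 0 := by
    rw [zero_smul, add_zero]; exact (hpos hv δ hδ).ne'
  simp only [barrier, dirDeriv_add, dirDeriv_smul, map_add, smul_eval] at key ⊢
  have hB : ContinuousAt (fun η : ℝ => eval (a + δ • (v + η • e)) (dirDeriv u f) /
      eval (a + δ • (v + η • e)) f) 0 := (hc _).continuousAt.div (hc _).continuousAt hne
  have hD : ContinuousAt (fun η : ℝ => ((eval (a + δ • (v + η • e)) (dirDeriv v (dirDeriv u f)) +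
      η * eval (a + δ • (v + η • e)) (dirDeriv e (dirDeriv u f))) * eval (a + δ • (v + η • e)) f -
      eval (a + δ • (v + η • e)) (dirDeriv u f) * (eval (a + δ • (v + η • e)) (dirDeriv v f) +
      η * eval (a + δ • (v + η • e)) (dirDeriv e f))) / eval (a + δ • (v + η • e)) f ^ 2) 0 := by
    refine ContinuousAt.div (Continuous.continuousAt ?_) ((hc _).pow 2).continuousAt
      (pow_ne_zero 2 hne)
    exact (((hc _).add (continuous_id.mul (hc _))).mul (hc _)).sub
      ((hc _).mul ((hc _).add (continuous_id.mul (hc _))))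
  have h1 := le_of_continuousAt_zero hB continuousAt_const fun η hη _ => (key η hη).1
  have h2 := le_of_continuousAt_zero hD continuousAt_const fun η hη _ => (key η hη).2.1
  have h3 := le_of_continuousAt_zero (hD.const_mul (-δ)) (continuousAt_const.sub hB)
    fun η hη _ => (key η hη).2.2
  simp only [Pi.sub_apply, zero_smul, add_zero, zero_mul] at h1 h2 h3
  exact ⟨h1, h2, h3⟩

theorem IsAbove.barrier_antitone {o : τ} {f : MvPolynomial τ ℝ} (hf : IsStable o f)
    {a b : τ → ℝ} (ha : IsAbove f a) {u : τ → ℝ} (hu : 0 ≤ u) (hab : a ≤ b) :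
    barrier u f b ≤ barrier u f a := by
  have := (ha.barrier_le_and_convex hf hu (sub_nonneg.2 hab) zero_le_one).1
  simpa using this

theorem eval_subDeriv {f : MvPolynomial τ ℝ} {v b : τ → ℝ} (h : eval b f ≠ 0) :
    eval b (subDeriv v f) = eval b f * (1 - barrier v f b) := by
  rw [subDeriv, map_sub, barrier]; field_simp

theorem IsAbove.subDeriv_of_barrier_lt {o : τ} {f : MvPolynomial τ ℝ} (hf : IsStable o f)
    {a : τ → ℝ} (ha : IsAbove f a) {v : τ → ℝ} (hv : 0 ≤ v) (h : barrier v f a < 1) :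
    IsAbove (subDeriv v f) a := by
  intro b hb
  rw [eval_subDeriv (ha b hb).ne']
  exact mul_pos (ha b hb) (by linarith [ha.barrier_antitone hf hv hb])

/-- The barrier step of Marcus, Spielman and Srivastava. -/
theorem IsAbove.barrier_step {o : τ} {f : MvPolynomial τ ℝ} (hf : IsStable o f)
    {a : τ → ℝ} (ha : IsAbove f a) {v : τ → ℝ} (hv : 0 ≤ v) {δ : ℝ} (hδ : 0 < δ)
    (h : barrier v f a ≤ 1 - 1 / δ) :
    IsAbove (subDeriv v f) (a + δ • v) ∧
      ∀ u, 0 ≤ u → barrier u (subDeriv v f) (a + δ • v) ≤ barrier u f a := by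
  have hab : a ≤ a + δ • v := le_add_of_nonneg_right (smul_nonneg hδ.le hv)
  have hδ' : 0 < 1 / δ := by positivity
  have hbv := ha.barrier_antitone hf hv hab
  refine ⟨(ha.mono hab).subDeriv_of_barrier_lt hf hv (by linarith), fun u hu => ?_⟩
  obtain ⟨-, h2, h3⟩ := ha.barrier_le_and_convex hf hu hv hδ.le
  have hF := ha _ hab
  rw [barrier, eval_subDeriv hF.ne', subDeriv, map_sub, map_sub, dirDeriv_comm]
  set F := eval (a + δ • v) f
  have hb1 : barrier v f (a + δ • v) = eval (a + δ • v) (dirDeriv v f) / F := rfl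
  have hb2 : barrier u f (a + δ • v) = eval (a + δ • v) (dirDeriv u f) / F := rfl
  set β := barrier v f (a + δ • v)
  set fu := eval (a + δ • v) (dirDeriv u f)
  set fv := eval (a + δ • v) (dirDeriv v f)
  set fuv := eval (a + δ • v) (dirDeriv v (dirDeriv u f))
  set K := (fuv * F - fu * fv) / F ^ 2 with hK
  have hβ : 1 / δ ≤ 1 - β := by linarith
  have hβ0 : 0 < 1 - β := by linarith
  have hβδ : 1 / (1 - β) ≤ δ := by
    rw [div_le_iff₀ hβ0]; rw [div_le_iff₀ hδ] at hβ; linarith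
  -- The new barrier is the old one minus `K / (1 - β)`, where `K ≤ 0` is its derivative along `v`.
  -- As `1 / (1 - β) ≤ δ`, this increase is at most `-δ K`, which by convexity is at most the drop
  -- gained by moving `δ v`.
  have e : (fu - fuv) / (F * (1 - β)) = fu / F + (-K) * (1 / (1 - β)) := by
    have : fv = β * F := by rw [hb1]; field_simp
    rw [hK, this]; field_simp; ring
  rw [e]
  have := mul_le_mul_of_nonneg_left hβδ (neg_nonneg.2 h2)
  rw [hb2] at h3
  linarith

/-- Successive application of the operators `1 - D_v`. -/
noncomputable def subDerivs (l : List (τ → ℝ)) (f : MvPolynomial τ ℝ) : MvPolynomial τ ℝ :=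
  l.foldr subDeriv f

@[simp] theorem subDerivs_nil (f : MvPolynomial τ ℝ) : subDerivs [] f = f := rfl

@[simp] theorem subDerivs_cons (v : τ → ℝ) (l : List (τ → ℝ)) (f : MvPolynomial τ ℝ) :
    subDerivs (v :: l) f = subDeriv v (subDerivs l f) := rfl

theorem subDerivs_append_singleton (l : List (τ → ℝ)) (v : τ → ℝ) (f : MvPolynomial τ ℝ) :
    subDerivs (l ++ [v]) f = subDerivs l (subDeriv v f) := by
  simp [subDerivs]

theorem subDerivs_subDeriv (l : List (τ → ℝ)) (v : τ → ℝ) (f : MvPolynomial τ ℝ) :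
    subDerivs l (subDeriv v f) = subDeriv v (subDerivs l f) := by
  induction l with
  | nil => rfl
  | cons w l ih => rw [subDerivs_cons, ih, subDeriv_comm, subDerivs_cons]

theorem IsStable.subDerivs {o : τ} {f : MvPolynomial τ ℝ} (hf : IsStable o f)
    {l : List (τ → ℝ)} (hl : ∀ v ∈ l, 0 ≤ v) : IsStable o (subDerivs l f) := by
  induction l with
  | nil => exact hf
  | cons v l ih =>
    exact (ih fun w hw => hl w (List.mem_cons_of_mem v hw)).subDeriv (hl v List.mem_cons_self)

theorem IsAbove.subDerivs {o : τ} {f : MvPolynomial τ ℝ} (hf : IsStable o f)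
    {a : τ → ℝ} (ha : IsAbove f a) {δ : ℝ} (hδ : 0 < δ) {l : List (τ → ℝ)}
    (hl : ∀ v ∈ l, 0 ≤ v) (h : ∀ v ∈ l, barrier v f a ≤ 1 - 1 / δ) :
    IsAbove (subDerivs l f) (a + δ • l.sum) ∧
      ∀ u, 0 ≤ u → barrier u (KadisonSinger.subDerivs l f) (a + δ • l.sum) ≤ barrier u f a := by
  induction l with
  | nil => exact ⟨by simpa using ha, fun u _ => by simp⟩
  | cons v l ih =>
    have hl' : ∀ w ∈ l, 0 ≤ w := fun w hw => hl w (List.mem_cons_of_mem v hw)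
    have hv := hl v List.mem_cons_self
    obtain ⟨h1, h2⟩ := ih hl' fun w hw => h w (List.mem_cons_of_mem v hw)
    obtain ⟨h3, h4⟩ := h1.barrier_step (hf.subDerivs hl') hv hδ
      ((h2 v hv).trans (h v List.mem_cons_self))
    have e : a + δ • (v :: l).sum = a + δ • l.sum + δ • v := by
      rw [List.sum_cons, smul_add]; abel
    rw [e]
    exact ⟨h3, fun u hu => (h4 u hu).trans (h2 u hu)⟩

end Stability

/-! ### From averaged operators to actual choices -/

section Selection

variable {τ : Type*}

/-- Removing an operator keeps `a` above the roots. Otherwise take the last point `μ` with `g ≤ 0`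
on a ray in direction `o`; it exists because `g` is eventually positive. There `g = 0`, so
positivity of `g - D_v g` forces `D_v g < 0`. But just beyond `μ` the barrier is at least its value
at `μ + 1`, so `D_v g` is at least a constant times `g`, which tends to `0`. -/
theorem IsAbove.of_subDeriv [DecidableEq τ] {o : τ} {g : MvPolynomial τ ℝ} (hg : IsStable o g)
    {v a : τ → ℝ} (hv : 0 ≤ v) (hev : ∃ s : ℝ, IsAbove g (a + s • Pi.single o 1))
    (h : IsAbove (subDeriv v g) a) : IsAbove g a := by
  intro b hab
  obtain ⟨S, hS⟩ := hev
  set e : τ → ℝ := Pi.single o 1 with he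
  have he0 : 0 ≤ e := by rw [he]; exact Pi.single_nonneg.2 zero_le_one
  have hpS : ∀ s, S ≤ s → 0 < eval (b + s • e) g := fun s hs =>
    hS _ (add_le_add hab (smul_le_smul_of_nonneg_right hs he0))
  have hcont : ∀ f : MvPolynomial τ ℝ, Continuous fun s : ℝ => eval (b + s • e) f :=
    fun f => (MvPolynomial.continuous_eval f).comp (by fun_prop)
  by_contra hcon
  set Z : Set ℝ := {s | 0 ≤ s ∧ eval (b + s • e) g ≤ 0} with hZ
  have hZne : Z.Nonempty := ⟨0, le_rfl, by simpa using hcon⟩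
  have hZb : BddAbove Z := ⟨S, fun s hs => by
    by_contra h; exact absurd (hpS s (not_le.1 h).le) (not_lt.2 hs.2)⟩
  have hZc : IsClosed Z := isClosed_Ici.inter (isClosed_le (hcont g) continuous_const)
  obtain ⟨hμ0, hμ1⟩ : sSup Z ∈ Z := hZc.csSup_mem hZne hZb
  set μ := sSup Z
  have hright : ∀ s, μ < s → 0 < eval (b + s • e) g := fun s hs => by
    by_contra h
    exact absurd (le_csSup hZb ⟨hμ0.trans hs.le, not_lt.1 h⟩) (not_le.2 hs)
  have hD : eval (b + μ • e) (dirDeriv v g) < 0 := by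
    have := h (b + μ • e) (hab.trans (le_add_of_nonneg_right (smul_nonneg hμ0 he0)))
    rw [subDeriv, map_sub] at this
    linarith
  have hc : ∀ f : MvPolynomial τ ℝ, ContinuousAt (fun η : ℝ => eval (b + (μ + η) • e) f) 0 :=
    fun f => ((hcont f).comp (continuous_const.add continuous_id)).continuousAt
  have hμ2 : 0 ≤ eval (b + μ • e) g := by
    have := le_of_continuousAt_zero continuousAt_const (hc g)
      fun η hη _ => (hright (μ + η) (by linarith)).le
    simpa using this
  have hlim := le_of_continuousAt_zero (f := fun η : ℝ => barrier v g (b + (μ + 1) • e) *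
      eval (b + (μ + η) • e) g) ((hc g).const_mul _) (hc (dirDeriv v g)) fun η hη hη1 => by
    have hpos := hright (μ + η) (by linarith)
    have := (hg.barrier_of_pos hv he0 (by simp [he]) (a := b + (μ + η) • e) (fun t ht => by
      rw [add_assoc, ← add_smul]
      exact (hright _ (by linarith)).ne') (δ := 1 - η) (by linarith)).1
    rw [add_assoc, ← add_smul, show μ + η + (1 - η) = μ + 1 by ring] at this
    rwa [barrier.eq_1 v g (b + (μ + η) • e), le_div_iff₀ hpos] at this
  simp only [add_zero, le_antisymm hμ1 hμ2, mul_zero] at hlim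
  linarith

theorem barrier_sum_smul {κ : Type*} (s : Finset κ) (c : κ → ℝ) (u : κ → τ → ℝ)
    (f : MvPolynomial τ ℝ) (a : τ → ℝ) :
    barrier (∑ j ∈ s, c j • u j) f a = ∑ j ∈ s, c j * barrier (u j) f a := by
  simp only [barrier, dirDeriv_sum, dirDeriv_smul, map_sum, smul_eval, Finset.sum_div, mul_div_assoc]

/-- The barrier is linear in its direction. The averaged barrier at `a` is below `1`, so some
individual one is, and monotonicity extends this to all points above `a`. -/
theorem IsAbove.exists_subDeriv {κ : Type*} [Fintype κ] {o : τ} {g : MvPolynomial τ ℝ}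
    (hg : IsStable o g) {a : τ → ℝ} {u : κ → τ → ℝ} (hu : ∀ j, 0 ≤ u j) {c : κ → ℝ}
    (hc : ∀ j, 0 ≤ c j) (hc1 : ∑ j, c j = 1) (hga : IsAbove g a)
    (h : IsAbove (subDeriv (∑ j, c j • u j) g) a) : ∃ j, IsAbove (subDeriv (u j) g) a := by
  by_contra! hcon
  have h1 : ∀ j, 1 ≤ barrier (u j) g a := fun j => by
    by_contra hj
    exact hcon j (hga.subDeriv_of_barrier_lt hg (hu j) (not_le.1 hj))
  have h2 := h.pos
  rw [eval_subDeriv hga.pos.ne', barrier_sum_smul] at h2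
  have h3 : ∑ j, c j * 1 ≤ ∑ j, c j * barrier (u j) g a :=
    Finset.sum_le_sum fun j _ => mul_le_mul_of_nonneg_left (h1 j) (hc j)
  simp only [mul_one, hc1] at h3
  have := pos_of_mul_pos_right h2 hga.pos.le
  linarith

/-- If `f` stays above its roots at `a` after applying averaged operators, then it does so after
applying some choice of the operators. -/
theorem IsAbove.exists_choice [DecidableEq τ] {ι κ : Type*} [DecidableEq ι] [Fintype κ] {o : τ}
    {a : τ → ℝ} {u : ι → κ → τ → ℝ} (hu : ∀ i j, 0 ≤ u i j) {c : κ → ℝ}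
    (hc : ∀ j, 0 ≤ c j) (hc1 : ∑ j, c j = 1) {P : (τ → ℝ) → Prop} (hP0 : ∀ v, P v → 0 ≤ v)
    (hPu : ∀ i j, P (u i j)) (hPv : ∀ i, P (∑ j, c j • u i j)) (σ₀ : ι → κ)
    (l : List ι) (hl : l.Nodup) : ∀ {f : MvPolynomial τ ℝ} (_ : IsStable o f)
    (_ : ∀ l : List (τ → ℝ), (∀ v ∈ l, P v) →
      ∃ s : ℝ, IsAbove (KadisonSinger.subDerivs l f) (a + s • Pi.single o 1))
    (_ : IsAbove (KadisonSinger.subDerivs (l.map fun i => ∑ j, c j • u i j) f) a),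
    ∃ σ : ι → κ, IsAbove (KadisonSinger.subDerivs (l.map fun i => u i (σ i)) f) a := by
  induction l with
  | nil => exact fun {f} _ _ h => ⟨σ₀, h⟩
  | cons i l ih =>
    intro f hf hev h
    rw [List.map_cons, subDerivs_cons] at h
    have hmem : ∀ v ∈ l.map fun i => ∑ j, c j • u i j, P v := by
      intro v hv
      obtain ⟨i', -, rfl⟩ := List.mem_map.1 hv
      exact hPv i'
    have hst := hf.subDerivs fun v hv => hP0 v (hmem v hv)
    have hab := IsAbove.of_subDeriv hst (hP0 _ (hPv i)) (hev _ hmem) h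
    obtain ⟨j, hj⟩ := hab.exists_subDeriv hst (hu i) hc hc1 h
    -- The operators commute, so the chosen one is absorbed into `f` and the induction continues on
    -- the remaining averaged ones.
    rw [← subDerivs_subDeriv] at hj
    obtain ⟨σ, hσ⟩ := ih (List.nodup_cons.1 hl).2 (hf.subDeriv (hu i j)) (fun l' hl' => by
      rw [← subDerivs_append_singleton]
      refine hev _ fun v hv => ?_
      rcases List.mem_append.1 hv with hv | hv
      · exact hl' v hv
      · rw [List.mem_singleton.1 hv]; exact hPu i j) hj
    refine ⟨Function.update σ i j, ?_⟩
    rw [List.map_cons, subDerivs_cons, Function.update_self, ← subDerivs_subDeriv]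
    convert hσ using 2
    refine List.map_congr_left fun k hk => ?_
    rw [Function.update_of_ne]
    rintro rfl
    exact (List.nodup_cons.1 hl).1 hk

end Selection

/-! ### The determinant of a Hermitian pencil of rank-one matrices -/

section Pencil

open Matrix
open scoped ComplexOrder

variable {E n : Type*} [Fintype E]

/-- The matrix `z₀ I + ∑ zₑ wₑ wₑ*`. -/
noncomputable def pencil [DecidableEq n] (w : E → n → ℂ) (z : Option E → ℂ) : Matrix n n ℂ :=
  z none • (1 : Matrix n n ℂ) + ∑ e, z (some e) • vecMulVec (w e) (star (w e))

theorem isHermitian_pencil [DecidableEq n] (w : E → n → ℂ) (a : Option E → ℝ) :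
    (pencil w fun i => (a i : ℂ)).IsHermitian := by
  rw [Matrix.IsHermitian, pencil, conjTranspose_add, conjTranspose_smul, conjTranspose_one,
    conjTranspose_sum]
  simp [conjTranspose_vecMulVec]

variable [Fintype n]

/-- The squared Euclidean norm of a complex vector. -/
noncomputable def sqNorm (x : n → ℂ) : ℝ := ∑ k, ‖x k‖ ^ 2

theorem star_dotProduct_self (x : n → ℂ) : star x ⬝ᵥ x = (sqNorm x : ℂ) := by
  simp only [dotProduct, sqNorm, Pi.star_apply, RCLike.star_def, Complex.conj_mul']
  push_cast; rfl

theorem sqNorm_nonneg (x : n → ℂ) : 0 ≤ sqNorm x := Finset.sum_nonneg fun _ _ => by positivity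

theorem sqNorm_pos {x : n → ℂ} (hx : x ≠ 0) : 0 < sqNorm x := by
  obtain ⟨k, hk⟩ := Function.ne_iff.1 hx
  exact Finset.sum_pos' (fun _ _ => by positivity)
    ⟨k, Finset.mem_univ k, by have : 0 < ‖x k‖ := norm_pos_iff.2 hk
                              positivity⟩

/-- Weighted inequality of arithmetic and geometric means for the inner product. -/
theorem two_mul_re_dotProduct_le (x y : n → ℂ) {c : ℝ} (hc : 0 < c) :
    2 * (star x ⬝ᵥ y).re ≤ c * sqNorm x + c⁻¹ * sqNorm y := by
  simp only [dotProduct, Complex.re_sum, sqNorm, Finset.mul_sum, ← Finset.sum_add_distrib]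
  refine Finset.sum_le_sum fun k _ => ?_
  have h1 : (star x k * y k).re ≤ ‖x k‖ * ‖y k‖ := by
    refine (Complex.re_le_norm _).trans ?_
    rw [norm_mul, Pi.star_apply, norm_star]
  have h2 : c * ‖x k‖ ^ 2 + c⁻¹ * ‖y k‖ ^ 2 - 2 * (‖x k‖ * ‖y k‖) =
      c⁻¹ * (c * ‖x k‖ - ‖y k‖) ^ 2 := by field_simp; ring
  have h3 : 0 ≤ c⁻¹ * (c * ‖x k‖ - ‖y k‖) ^ 2 := by positivity
  linarith

theorem norm_dotProduct_sq_le (x y : n → ℂ) : ‖star x ⬝ᵥ y‖ ^ 2 ≤ sqNorm x * sqNorm y := by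
  have h1 : ‖star x ⬝ᵥ y‖ ≤ ∑ k, ‖x k‖ * ‖y k‖ := by
    refine (norm_sum_le _ _).trans (Finset.sum_le_sum fun k _ => ?_)
    rw [norm_mul, Pi.star_apply, norm_star]
  exact (pow_le_pow_left₀ (norm_nonneg _) h1 2).trans (Finset.sum_mul_sq_le_sq_mul_sq _ _ _)

/-- The pencil at the real point `a` is bounded below by `c`. -/
def IsCoercive (w : E → n → ℂ) (a : Option E → ℝ) (c : ℝ) : Prop :=
  ∀ x : n → ℂ, c * sqNorm x ≤ a none * sqNorm x + ∑ e, a (some e) * ‖star (w e) ⬝ᵥ x‖ ^ 2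

theorem IsCoercive.mono {w : E → n → ℂ} {a b : Option E → ℝ} {c : ℝ}
    (h : IsCoercive w a c) (hab : a ≤ b) : IsCoercive w b c := fun x => by
  refine (h x).trans (add_le_add ?_ (Finset.sum_le_sum fun e _ => ?_))
  · exact mul_le_mul_of_nonneg_right (hab none) (sqNorm_nonneg x)
  · exact mul_le_mul_of_nonneg_right (hab (some e)) (by positivity)

theorem exists_isCoercive [DecidableEq E] (w : E → n → ℂ) (a : Option E → ℝ) :
    ∃ K : ℝ, ∀ t : ℝ, IsCoercive w (a + t • Pi.single none 1) (t - K) := by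
  refine ⟨|a none| + ∑ e, |a (some e)| * sqNorm (w e), fun t x => ?_⟩
  have h1 : ∀ e, -(|a (some e)| * sqNorm (w e) * sqNorm x) ≤
      a (some e) * ‖star (w e) ⬝ᵥ x‖ ^ 2 := fun e => by
    have h2 := mul_le_mul_of_nonneg_left (norm_dotProduct_sq_le (w e) x) (abs_nonneg (a (some e)))
    have h3 : -|a (some e)| * ‖star (w e) ⬝ᵥ x‖ ^ 2 ≤ a (some e) * ‖star (w e) ⬝ᵥ x‖ ^ 2 :=
      mul_le_mul_of_nonneg_right (neg_abs_le _) (by positivity)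
    linarith
  have h2 := Finset.sum_le_sum fun e (_ : e ∈ Finset.univ) => h1 e
  rw [Finset.sum_neg_distrib, ← Finset.sum_mul] at h2
  have h3 := mul_le_mul_of_nonneg_right (neg_abs_le (a none)) (sqNorm_nonneg x)
  simp only [Pi.add_apply, Pi.smul_apply, Pi.single_eq_same, smul_eq_mul, mul_one, ne_eq,
    reduceCtorEq, not_false_eq_true, Pi.single_eq_of_ne, mul_zero, add_zero]
  linarith

variable [DecidableEq n]

theorem star_dotProduct_pencil (w : E → n → ℂ) (z : Option E → ℂ) (x : n → ℂ) :
    star x ⬝ᵥ (pencil w z *ᵥ x) =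
      z none * (sqNorm x : ℂ) + ∑ e, z (some e) * ((‖star (w e) ⬝ᵥ x‖ ^ 2 : ℝ) : ℂ) := by
  rw [pencil, add_mulVec, dotProduct_add, smul_mulVec, one_mulVec, dotProduct_smul,
    star_dotProduct_self, smul_eq_mul, sum_mulVec, dotProduct_sum]
  congr 1
  refine Finset.sum_congr rfl fun e _ => ?_
  rw [smul_mulVec, dotProduct_smul, vecMulVec_mulVec, smul_eq_mul]
  congr 1
  have : star x ⬝ᵥ w e = star (star (w e) ⬝ᵥ x) := by
    rw [star_dotProduct]
  rw [dotProduct_smul, this]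
  simp [Complex.conj_mul']

/-- For a kernel vector `x`, the imaginary part of `x* M x` would be at least `Im z₀ ‖x‖² > 0`. -/
theorem det_pencil_ne_zero (w : E → n → ℂ) {z : Option E → ℂ} (hz : 0 < (z none).im)
    (hz' : ∀ i, 0 ≤ (z i).im) : (pencil w z).det ≠ 0 := by
  intro h
  obtain ⟨x, hx, hx0⟩ := exists_mulVec_eq_zero_iff.2 h
  have h1 := congrArg Complex.im (star_dotProduct_pencil w z x)
  rw [hx0, dotProduct_zero, Complex.add_im, Complex.im_sum, Complex.im_mul_ofReal] at h1
  have h2 : 0 ≤ ∑ e, (z (some e) * ((‖star (w e) ⬝ᵥ x‖ ^ 2 : ℝ) : ℂ)).im :=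
    Finset.sum_nonneg fun e _ => by
      rw [Complex.im_mul_ofReal]; exact mul_nonneg (hz' _) (by positivity)
  have h3 := mul_pos hz (sqNorm_pos hx)
  simp only [Complex.zero_im] at h1
  linarith

/-- The determinant of the pencil is a polynomial with real coefficients. -/
theorem exists_detPoly (w : E → n → ℂ) :
    ∃ G : MvPolynomial (Option E) ℝ, ∀ z : Option E → ℂ, aeval z G = (pencil w z).det := by
  set A : Matrix n n (MvPolynomial (Option E) ℂ) :=
    (X none : MvPolynomial (Option E) ℂ) • (1 : Matrix n n (MvPolynomial (Option E) ℂ)) +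
      ∑ e, (X (some e) : MvPolynomial (Option E) ℂ) • (vecMulVec (w e) (star (w e))).map C with hA
  have hev : ∀ z, eval z A.det = (pencil w z).det := by
    intro z
    rw [RingHom.map_det]
    congr 1
    ext i j
    simp [hA, pencil, Matrix.sum_apply, Matrix.one_apply, apply_ite]
  -- At real points the matrix is Hermitian and its determinant real; values at real points
  -- determine the polynomial.
  have hconj : MvPolynomial.map (starRingEnd ℂ) A.det = A.det := by
    refine funext_set (fun _ => Set.range ((↑) : ℝ → ℂ))
      (fun _ => Set.infinite_range_of_injective Complex.ofReal_injective) fun x hx => ?_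
    have : ∀ i, ∃ r : ℝ, (r : ℂ) = x i := fun i => hx i trivial
    choose a ha using this
    obtain rfl : (fun i => (a i : ℂ)) = x := funext ha
    have h1 : eval (fun i => (a i : ℂ)) (MvPolynomial.map (starRingEnd ℂ) A.det) =
        starRingEnd ℂ (eval (fun i => (a i : ℂ)) A.det) := by
      rw [eval_map, eval, coe_eval₂Hom, eval₂_comp_left]
      congr 1
      ext i; simp
    rw [h1, hev, ← RCLike.star_def, ← det_conjTranspose, isHermitian_pencil w a]
  obtain ⟨G, hG⟩ : A.det ∈ Set.range (MvPolynomial.map (algebraMap ℝ ℂ)) := by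
    rw [mem_range_map_iff_coeffs_subset]
    intro c hc
    obtain ⟨m, -, rfl⟩ := mem_coeffs_iff.1 hc
    have := congrArg (coeff m) hconj
    rw [coeff_map] at this
    obtain ⟨r, hr⟩ := Complex.conj_eq_iff_real.1 this
    exact ⟨r, hr.symm⟩
  refine ⟨G, fun z => ?_⟩
  rw [← hev, ← hG, eval_map, aeval_def]

theorem ofReal_eval_detPoly {w : E → n → ℂ} {G : MvPolynomial (Option E) ℝ}
    (hG : ∀ z : Option E → ℂ, aeval z G = (pencil w z).det) (a : Option E → ℝ) :
    ((eval a G : ℝ) : ℂ) = (pencil w fun i => (a i : ℂ)).det := by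
  rw [← hG]
  exact (aeval_algebraMap_apply ℂ a G).symm

theorem isStable_detPoly {w : E → n → ℂ} {G : MvPolynomial (Option E) ℝ}
    (hG : ∀ z : Option E → ℂ, aeval z G = (pencil w z).det) : IsStable none G := fun z hz hz' => by
  rw [hG]; exact det_pencil_ne_zero w hz hz'

theorem re_star_dotProduct_pencil (w : E → n → ℂ) (a : Option E → ℝ) (x : n → ℂ) :
    (star x ⬝ᵥ (pencil w (fun i => (a i : ℂ)) *ᵥ x)) =
      ((a none * sqNorm x + ∑ e, a (some e) * ‖star (w e) ⬝ᵥ x‖ ^ 2 : ℝ) : ℂ) := by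
  rw [star_dotProduct_pencil]; push_cast; rfl

theorem IsCoercive.posDef {w : E → n → ℂ} {a : Option E → ℝ} {c : ℝ} (hc : 0 < c)
    (h : IsCoercive w a c) : (pencil w fun i => (a i : ℂ)).PosDef := by
  refine PosDef.of_dotProduct_mulVec_pos (isHermitian_pencil w a) fun x hx => ?_
  rw [re_star_dotProduct_pencil]
  exact_mod_cast (mul_pos hc (sqNorm_pos hx)).trans_le (h x)

theorem IsCoercive.isAbove {w : E → n → ℂ} {G : MvPolynomial (Option E) ℝ}
    (hG : ∀ z : Option E → ℂ, aeval z G = (pencil w z).det) {a : Option E → ℝ} {c : ℝ}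
    (hc : 0 < c) (h : IsCoercive w a c) : IsAbove G a := fun b hb => by
  have := ((h.mono hb).posDef hc).det_pos
  rw [← ofReal_eval_detPoly hG] at this
  exact_mod_cast this

variable [DecidableEq E]

/-- By the matrix determinant lemma `β` is `w* M⁻¹ w`, with `w = w e`. With `y = M⁻¹ w`, coercivity
gives `c ‖y‖² ≤ β`, and `2β ≤ c ‖y‖² + ‖w‖² / c` then gives the bound. -/
theorem IsCoercive.exists_eval_add_single {w : E → n → ℂ} {G : MvPolynomial (Option E) ℝ}
    (hG : ∀ z : Option E → ℂ, aeval z G = (pencil w z).det) {a : Option E → ℝ} {c : ℝ}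
    (hc : 0 < c) (h : IsCoercive w a c) (e : E) :
    ∃ β : ℝ, β ≤ sqNorm (w e) / c ∧
      ∀ t : ℝ, eval (a + t • Pi.single (some e) 1) G = eval a G * (1 + t * β) := by
  set M := pencil w fun i => (a i : ℂ) with hM
  have hdet : IsUnit M.det := (isUnit_iff_isUnit_det _).1 (h.posDef hc).isUnit
  set y := M⁻¹ *ᵥ w e with hy
  have hMy : M *ᵥ y = w e := by
    rw [hy, mulVec_mulVec, mul_nonsing_inv _ hdet, one_mulVec]
  have hre : (star y ⬝ᵥ w e).re = (star (w e) ⬝ᵥ y).re := by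
    have : star y ⬝ᵥ w e = star (star (w e) ⬝ᵥ y) := by rw [star_dotProduct]
    rw [this, RCLike.star_def, Complex.conj_re]
  have hcy := h y
  have hform := congrArg Complex.re (re_star_dotProduct_pencil w a y)
  rw [← hM, hMy, Complex.ofReal_re, hre] at hform
  rw [← hform] at hcy
  have hyw := two_mul_re_dotProduct_le y (w e) hc
  rw [hre] at hyw
  refine ⟨(star (w e) ⬝ᵥ y).re, ?_, fun t => ?_⟩
  · rw [div_eq_inv_mul]; linarith
  · have h1 : (pencil w fun i => ((a + t • Pi.single (some e) 1 : Option E → ℝ) i : ℂ)) =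
        M + replicateCol Unit ((t : ℂ) • w e) * replicateRow Unit (star (w e)) := by
      rw [← vecMulVec_eq, hM, pencil, pencil, add_assoc]
      congr 1
      · simp
      · rw [smul_vecMulVec, ← Finset.sum_erase_add _ _ (Finset.mem_univ e),
          ← Finset.sum_erase_add Finset.univ (fun e => (a (some e) : ℂ) • _)
            (Finset.mem_univ e), add_assoc, ← add_smul]
        congr 1
        · refine Finset.sum_congr rfl fun e' he' => ?_
          simp [Finset.ne_of_mem_erase he']
        · simp
    have h2 := ofReal_eval_detPoly hG (a + t • Pi.single (some e) 1)
    rw [h1, det_add_replicateCol_mul_replicateRow hdet, ← ofReal_eval_detPoly hG] at h2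
    have h3 := congrArg Complex.re h2
    rw [Complex.ofReal_re, Complex.re_ofReal_mul, det_unique] at h3
    rw [h3]
    congr 1
    rw [Matrix.add_apply, Matrix.mul_assoc, Matrix.one_apply_eq, ← replicateCol_mulVec,
      replicateRow_mul_replicateCol_apply, mulVec_smul, dotProduct_smul, ← hy]
    simp

theorem IsCoercive.barrier_single_le {w : E → n → ℂ} {G : MvPolynomial (Option E) ℝ}
    (hG : ∀ z : Option E → ℂ, aeval z G = (pencil w z).det) {a : Option E → ℝ} {c : ℝ}
    (hc : 0 < c) (h : IsCoercive w a c) (e : E) :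
    barrier (Pi.single (some e) 1) G a ≤ sqNorm (w e) / c ∧
      eval a (subDeriv (Pi.single (some e) 1) G) = eval (a - Pi.single (some e) 1) G := by
  obtain ⟨β, hβ, ht⟩ := h.exists_eval_add_single hG hc e
  have hpos := (h.isAbove hG hc).pos
  have h1 := hasDerivAt_eval_line a (Pi.single (some e) 1) G
  simp only [ht] at h1
  have h2 : HasDerivAt (fun t : ℝ => eval a G * (1 + t * β)) (eval a G * β) 0 := by
    simpa using (((hasDerivAt_id (0 : ℝ)).mul_const β).const_add 1).const_mul (eval a G)
  have h3 := h1.unique h2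
  constructor
  · rw [barrier, h3, mul_div_cancel_left₀ _ hpos.ne']; exact hβ
  · have := ht (-1)
    rw [neg_one_smul, ← sub_eq_add_neg] at this
    rw [subDeriv, map_sub, h3, this]; ring

theorem IsCoercive.barrier_le {w : E → n → ℂ} {G : MvPolynomial (Option E) ℝ}
    (hG : ∀ z : Option E → ℂ, aeval z G = (pencil w z).det) {a : Option E → ℝ} {c : ℝ}
    (hc : 0 < c) (h : IsCoercive w a c) {v : Option E → ℝ} (hv : 0 ≤ v) (hv0 : v none = 0) :
    barrier v G a ≤ (∑ e, v (some e) * sqNorm (w e)) / c := by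
  have : v = ∑ e, v (some e) • Pi.single (some e) 1 := by
    ext i
    cases i with
    | none => simp [hv0]
    | some e => simp [Finset.sum_apply, Pi.single_apply]
  rw [this, barrier_sum_smul, Finset.sum_div]
  refine Finset.sum_le_sum fun e _ => ?_
  rw [← this, mul_div_assoc]
  exact mul_le_mul_of_nonneg_left (h.barrier_single_le hG hc e).1 (hv _)

/-- Far along the identity direction the pencil is coercive and the identity is known. Both sides
are polynomials along that line, so it holds everywhere. -/
theorem eval_subDeriv_single {w : E → n → ℂ} {G : MvPolynomial (Option E) ℝ}
    (hG : ∀ z : Option E → ℂ, aeval z G = (pencil w z).det) (a : Option E → ℝ) (e : E) :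
    eval a (subDeriv (Pi.single (some e) 1) G) = eval (a - Pi.single (some e) 1) G := by
  obtain ⟨K, hK⟩ := exists_isCoercive w a
  have h : line a (Pi.single none 1) (subDeriv (Pi.single (some e) 1) G) =
      line (a - Pi.single (some e) 1) (Pi.single none 1) G := by
    refine Polynomial.eq_of_infinite_eval_eq _ _ ((Set.Ioi_infinite K).mono fun t ht => ?_)
    rw [Set.mem_ofPred_eq, eval_line, eval_line,
      ((hK t).barrier_single_le hG (sub_pos.2 ht) e).2, sub_add_eq_add_sub]
  have := congrArg (Polynomial.eval 0) h
  simpa [eval_line] using this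

theorem eval_subDerivs_single {w : E → n → ℂ} {G : MvPolynomial (Option E) ℝ}
    (hG : ∀ z : Option E → ℂ, aeval z G = (pencil w z).det) (l : List E) (a : Option E → ℝ) :
    eval a (subDerivs (l.map fun e => Pi.single (some e) 1) G) =
      eval (a - (l.map fun e => Pi.single (some e) (1 : ℝ)).sum) G := by
  induction l generalizing a with
  | nil => simp
  | cons e l ih =>
    have h1 := hasDerivAt_eval_line a (Pi.single (some e) 1)
      (subDerivs (l.map fun e => Pi.single (some e) 1) G)
    simp only [ih, add_sub_right_comm] at h1
    have h2 := h1.unique (hasDerivAt_eval_line _ _ _)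
    rw [List.map_cons, subDerivs_cons, subDeriv, map_sub, h2, ih, ← map_sub, ← subDeriv,
      eval_subDeriv_single hG, List.sum_cons]
    congr 2
    abel

/-- Supplies the eventual positivity needed for selection. Far out, all barriers at the point
shifted back by `2 • l.sum` are at most `S / (1 + 2S) ≤ 1/2`, so barrier steps with `δ = 2` return
to the required point. -/
theorem exists_isAbove_subDerivs {w : E → n → ℂ} {G : MvPolynomial (Option E) ℝ}
    (hG : ∀ z : Option E → ℂ, aeval z G = (pencil w z).det) (a : Option E → ℝ)
    (l : List (Option E → ℝ)) (hl : ∀ v ∈ l, 0 ≤ v ∧ v none = 0) :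
    ∃ s : ℝ, IsAbove (subDerivs l G) (a + s • Pi.single none 1) := by
  obtain ⟨K, hK⟩ := exists_isCoercive w (a - (2 : ℝ) • l.sum)
  set T : (Option E → ℝ) → ℝ := fun v => ∑ e, v (some e) * sqNorm (w e) with hT
  have hT0 : ∀ v ∈ l, 0 ≤ T v := fun v hv =>
    Finset.sum_nonneg fun e _ => mul_nonneg ((hl v hv).1 _) (sqNorm_nonneg _)
  have hTl : ∀ x ∈ l.map T, 0 ≤ x := fun x hx => by
    obtain ⟨v, hv, rfl⟩ := List.mem_map.1 hx; exact hT0 v hv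
  set S := (l.map T).sum with hS
  have hS0 : 0 ≤ S := List.sum_nonneg hTl
  refine ⟨K + (1 + 2 * S), ?_⟩
  have hco := hK (K + (1 + 2 * S))
  rw [add_sub_cancel_left] at hco
  have hc : 0 < 1 + 2 * S := by linarith
  have := ((hco.isAbove hG hc).subDerivs (isStable_detPoly hG) two_pos (fun v hv => (hl v hv).1)
    fun v hv => ?_).1
  · convert this using 1
    abel
  · refine (hco.barrier_le hG hc (hl v hv).1 (hl v hv).2).trans ?_
    have : T v ≤ S := List.single_le_sum hTl _ (List.mem_map_of_mem hv)
    rw [div_le_iff₀ hc]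
    change T v ≤ _
    linarith

/-- If the characteristic polynomial of a positive matrix has no zeros beyond `R`, then the matrix
is at most `R`. -/
theorem le_of_isAbove_detPoly {w : E → n → ℂ} {G : MvPolynomial (Option E) ℝ}
    (hG : ∀ z : Option E → ℂ, aeval z G = (pencil w z).det) {a : Option E → ℝ} (h : IsAbove G a)
    (x : n → ℂ) : 0 ≤ a none * sqNorm x + ∑ e, a (some e) * ‖star (w e) ⬝ᵥ x‖ ^ 2 := by
  have hH := isHermitian_pencil w a
  have hpsd : (pencil w fun i => (a i : ℂ)).PosSemidef := by
    rw [hH.posSemidef_iff_eigenvalues_nonneg]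
    intro i
    by_contra hneg
    rw [Pi.zero_apply, not_le] at hneg
    set μ := hH.eigenvalues i
    -- Moving up by `-μ > 0` in the identity direction makes the determinant vanish, although the
    -- new point is still above the roots.
    have h1 := h (a + (-μ) • Pi.single none 1) (le_add_of_nonneg_right
      (smul_nonneg (by linarith) (Pi.single_nonneg.2 zero_le_one)))
    have h2 : (pencil w fun i => ((a + (-μ) • Pi.single none 1 : Option E → ℝ) i : ℂ)) =
        (pencil w fun i => (a i : ℂ)) - (μ : ℂ) • 1 := by
      simp [pencil, add_smul, sub_eq_add_neg]
      abel
    have h3 := ofReal_eval_detPoly hG (a + (-μ) • Pi.single none 1)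
    rw [h2, exists_mulVec_eq_zero_iff.1] at h3
    · rw [Complex.ofReal_eq_zero] at h3; linarith
    · refine ⟨(hH.eigenvectorBasis i).ofLp, ?_, ?_⟩
      · intro h0
        have := (hH.eigenvectorBasis.orthonormal.ne_zero i)
        exact this (by ext k; exact congrFun h0 k)
      · rw [sub_mulVec, hH.mulVec_eigenvectorBasis, smul_mulVec, one_mulVec]
        ext k
        simp [μ]
  have := hpsd.dotProduct_mulVec_nonneg x
  rw [re_star_dotProduct_pencil] at this
  exact_mod_cast this

end Pencil

/-! ### Marcus–Spielman–Srivastava and paving -/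

section Paving

open Matrix
open scoped ComplexOrder

/-- The theorem of Marcus, Spielman and Srivastava for choices which are uniform on finite sets. -/
theorem exists_choice_sum_le {ι κ n : Type*} [Fintype ι] [Fintype κ] [Nonempty κ] [Fintype n]
    {w : ι → κ → n → ℂ} {δ : ℝ} (hδ : 0 < δ) (hw : ∀ i j, sqNorm (w i j) ≤ δ)
    (hsum : ∀ x : n → ℂ,
      ∑ i, ∑ j, (Fintype.card κ : ℝ)⁻¹ * ‖star (w i j) ⬝ᵥ x‖ ^ 2 ≤ sqNorm x) :
    ∃ σ : ι → κ, ∀ x : n → ℂ,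
      ∑ i, ‖star (w i (σ i)) ⬝ᵥ x‖ ^ 2 ≤ (1 + √δ) ^ 2 * sqNorm x := by
  classical
  set W : ι × κ → n → ℂ := fun e => w e.1 e.2 with hW
  obtain ⟨G, hG⟩ := exists_detPoly W
  set c : κ → ℝ := fun _ => (Fintype.card κ : ℝ)⁻¹ with hc
  have hc0 : ∀ j, 0 ≤ c j := fun j => by positivity
  have hc1 : ∑ j, c j = 1 := by
    rw [hc, Finset.sum_const, Finset.card_univ, nsmul_eq_mul, mul_inv_cancel₀]
    exact_mod_cast Fintype.card_ne_zero
  set u : ι → κ → Option (ι × κ) → ℝ := fun i j => Pi.single (some (i, j)) 1 with hu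
  have hu0 : ∀ i j, 0 ≤ u i j := fun i j => Pi.single_nonneg.2 zero_le_one
  set v : ι → Option (ι × κ) → ℝ := fun i => ∑ j, c j • u i j with hv
  have hv0 : ∀ i, 0 ≤ v i := fun i => Finset.sum_nonneg fun j _ => smul_nonneg (hc0 j) (hu0 i j)
  have hvn : ∀ i, v i none = 0 := fun i => by simp [hv, hu, Finset.sum_apply]
  have hs : 0 < √δ := Real.sqrt_pos.2 hδ
  have hss : √δ * √δ = δ := Real.mul_self_sqrt hδ.le
  -- Barrier steps of length `t` lead from `a` to `b`. At `a` the pencil is at least `t² - t = t√δ`,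
  -- so the barriers are at most `δ / (t√δ) = √δ / t = 1 - 1/t`, exactly what a step of length `t`
  -- allows.
  set t : ℝ := 1 + √δ with ht
  set b : Option (ι × κ) → ℝ := t ^ 2 • Pi.single none 1 with hb
  set a : Option (ι × κ) → ℝ := b - t • ∑ i, v i with ha
  have hve : ∀ i j, (∑ k, v k) (some (i, j)) = (Fintype.card κ : ℝ)⁻¹ := fun i j => by
    rw [Finset.sum_apply, Finset.sum_eq_single i]
    · rw [hv]; simp only [Finset.sum_apply]
      rw [Finset.sum_eq_single j]
      · simp [hu, hc]
      · intro k _ hk; simp [hu, hk.symm]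
      · simp
    · intro k _ hk; simp [hv, hu, Finset.sum_apply, hk.symm]
    · simp
  have hco : IsCoercive W a (t * √δ) := fun x => by
    have h1 : a none = t ^ 2 := by simp [ha, hb, Finset.sum_apply, hvn]
    have h2 : ∀ i j, a (some (i, j)) = -t * (Fintype.card κ : ℝ)⁻¹ := fun i j => by
      rw [ha, Pi.sub_apply, Pi.smul_apply, hve]; simp [hb]
    rw [h1, Fintype.sum_prod_type]
    simp only [h2, mul_assoc, ← Finset.mul_sum]
    have h3 := mul_le_mul_of_nonneg_left (hsum x) (by positivity : 0 ≤ t)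
    simp only [← Finset.mul_sum] at h3
    have h4 : t ^ 2 = t * √δ + t := by rw [ht]; ring
    rw [h4]
    simp only [hW]
    linarith
  have hcpos : 0 < t * √δ := by positivity
  have hbar : ∀ w ∈ Finset.univ.toList.map v, barrier w G a ≤ 1 - 1 / t := by
    intro w' hw'
    obtain ⟨i, -, rfl⟩ := List.mem_map.1 hw'
    rw [hv, barrier_sum_smul]
    have h1 : ∀ j, c j * barrier (u i j) G a ≤ c j * (δ / (t * √δ)) := fun j =>
      mul_le_mul_of_nonneg_left ((hco.barrier_single_le hG hcpos (i, j)).1.trans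
        (div_le_div_of_nonneg_right (hw i j) hcpos.le)) (hc0 j)
    refine (Finset.sum_le_sum fun j _ => h1 j).trans ?_
    rw [← Finset.sum_mul, hc1, one_mul]
    apply le_of_eq
    have : t ≠ 0 := by positivity
    rw [div_eq_iff hcpos.ne']
    field_simp
    rw [ht]; linarith
  have hst := isStable_detPoly hG
  have hmem : ∀ w ∈ Finset.univ.toList.map v, 0 ≤ w := fun w' hw' => by
    obtain ⟨i, -, rfl⟩ := List.mem_map.1 hw'; exact hv0 i
  have h1 := ((hco.isAbove hG hcpos).subDerivs hst (by positivity : 0 < t) hmem hbar).1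
  rw [Finset.sum_map_toList, ha, sub_add_cancel] at h1
  obtain ⟨σ, hσ⟩ := IsAbove.exists_choice hu0 hc0 hc1
    (P := fun v => 0 ≤ v ∧ v none = 0) (fun v h => h.1)
    (fun i j => ⟨hu0 i j, by simp [hu]⟩) (fun i => ⟨hv0 i, hvn i⟩)
    (fun _ => Classical.arbitrary κ) Finset.univ.toList (Finset.nodup_toList _) hst
    (exists_isAbove_subDerivs hG b) h1
  have hmap : (Finset.univ.toList.map fun i => u i (σ i)) =
      (Finset.univ.toList.map fun i => (i, σ i)).map fun e => Pi.single (some e) 1 := by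
    rw [List.map_map]; rfl
  have hsumσ : ((Finset.univ.toList.map fun i => (i, σ i)).map
      fun e => Pi.single (some e) (1 : ℝ)).sum = ∑ i, u i (σ i) := by
    rw [← hmap, Finset.sum_map_toList]
  have h2 : IsAbove G (b - ∑ i, u i (σ i)) := fun x hx => by
    have := hσ (x + ∑ i, u i (σ i)) (by rwa [sub_le_iff_le_add] at hx)
    rwa [hmap, eval_subDerivs_single hG, hsumσ, add_sub_cancel_right] at this
  refine ⟨σ, fun x => ?_⟩
  have h3 := le_of_isAbove_detPoly hG h2 x
  have h4 : (b - ∑ i, u i (σ i)) none = t ^ 2 := by simp [hb, hu, Finset.sum_apply]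
  have h5 : ∀ i j, (b - ∑ i, u i (σ i)) (some (i, j)) = if σ i = j then -1 else 0 := fun i j => by
    simp only [hb, hu, Pi.sub_apply, Pi.smul_apply, Finset.sum_apply, Pi.single_apply]
    rw [Finset.sum_eq_single i]
    · by_cases h : σ i = j
      · simp [h]
      · simp [h, Ne.symm h]
    · intro k _ hk; simp [hk.symm]
    · simp
  rw [h4, Fintype.sum_prod_type] at h3
  simp only [h5, ite_mul, neg_one_mul, zero_mul, Finset.sum_ite_eq, Finset.mem_univ, if_true,
    Finset.sum_neg_distrib] at h3
  linarith

theorem sqNorm_smul {n : Type*} [Fintype n] (c : ℂ) (x : n → ℂ) :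
    sqNorm (c • x) = ‖c‖ ^ 2 * sqNorm x := by
  simp only [sqNorm, Pi.smul_apply, smul_eq_mul, norm_mul, mul_pow, Finset.mul_sum]

theorem star_dotProduct_sum_smul {ι n : Type*} [Fintype ι] [Fintype n] (u : ι → n → ℂ)
    (x : n → ℂ) (y : ι → ℂ) :
    star x ⬝ᵥ ∑ i, y i • u i = star (fun i => star (u i) ⬝ᵥ x) ⬝ᵥ y := by
  rw [dotProduct_sum]
  simp only [dotProduct_smul]
  refine Finset.sum_congr rfl fun i _ => ?_
  rw [Pi.star_apply, ← star_dotProduct, smul_eq_mul, mul_comm]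

/-- A Bessel bound for the synthesis operator is a Bessel bound for the analysis operator. -/
theorem sum_norm_sq_le_of_synthesis {ι n : Type*} [Fintype ι] [Fintype n] {u : ι → n → ℂ}
    (h : ∀ y : ι → ℂ, sqNorm (∑ i, y i • u i) ≤ sqNorm y) (x : n → ℂ) :
    ∑ i, ‖star (u i) ⬝ᵥ x‖ ^ 2 ≤ sqNorm x := by
  set y : ι → ℂ := fun i => star (u i) ⬝ᵥ x with hy
  have h1 := two_mul_re_dotProduct_le x (∑ i, y i • u i) one_pos
  rw [star_dotProduct_sum_smul, ← hy, star_dotProduct_self, Complex.ofReal_re, inv_one, one_mul,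
    one_mul] at h1
  have h2 := h y
  change sqNorm y ≤ sqNorm x
  linarith

/-- Choosing a colour for `i` means choosing in which of `r` orthogonal copies of the space to put
`√r u i`. Averaging the rank-one operators over colours gives copies of `∑ u i (u i)*`, at most the
identity. The resulting bound restricted to one copy is an analysis bound for that colour class, and
duality gives the synthesis bound. -/
theorem exists_coloring_of_vectors {ι n : Type*} [Fintype ι] [Fintype n] {u : ι → n → ℂ}
    (h : ∀ y : ι → ℂ, sqNorm (∑ i, y i • u i) ≤ sqNorm y) {δ : ℝ} (hδ : 0 < δ)
    (hu : ∀ i, sqNorm (u i) ≤ δ) {r : ℕ} (hr : 0 < r) :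
    ∃ σ : ι → Fin r, ∀ j, ∀ y : ι → ℂ, (∀ i, σ i ≠ j → y i = 0) →
      sqNorm (∑ i, y i • u i) ≤ (1 + √(r * δ)) ^ 2 / r * sqNorm y := by
  classical
  have : Nonempty (Fin r) := ⟨⟨0, hr⟩⟩
  have hr0 : (0 : ℝ) < r := by exact_mod_cast hr
  have hrc : ‖((√r : ℝ) : ℂ)‖ ^ 2 = r := by
    rw [Complex.norm_real, Real.norm_eq_abs, sq_abs, Real.sq_sqrt hr0.le]
  set w : ι → Fin r → Fin r × n → ℂ :=
    fun i j p => if p.1 = j then ((√r : ℝ) : ℂ) * u i p.2 else 0 with hw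
  have hwN : ∀ i j, sqNorm (w i j) = r * sqNorm (u i) := fun i j => by
    rw [← hrc, ← sqNorm_smul, sqNorm, Fintype.sum_prod_type, Finset.sum_eq_single j]
    · simp [hw, sqNorm]
    · intro k _ hk; simp [hw, hk]
    · simp
  have hwd : ∀ i j (x : Fin r × n → ℂ),
      ‖star (w i j) ⬝ᵥ x‖ ^ 2 = r * ‖star (u i) ⬝ᵥ fun k => x (j, k)‖ ^ 2 := fun i j x => by
    rw [← hrc, ← mul_pow, ← norm_mul, dotProduct, Fintype.sum_prod_type, Finset.sum_eq_single j]
    · congr 2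
      rw [dotProduct, Finset.mul_sum]
      refine Finset.sum_congr rfl fun k _ => ?_
      simp [hw, mul_assoc]
    · intro k _ hk; simp [hw, hk]
    · simp
  obtain ⟨σ, hσ⟩ := exists_choice_sum_le (w := w) (mul_pos hr0 hδ)
    (fun i j => by rw [hwN]; exact mul_le_mul_of_nonneg_left (hu i) hr0.le) fun x => by
      simp only [hwd, Fintype.card_fin, inv_mul_cancel_left₀ hr0.ne']
      rw [Finset.sum_comm, sqNorm, Fintype.sum_prod_type]
      exact Finset.sum_le_sum fun j _ => sum_norm_sq_le_of_synthesis h fun k => x (j, k)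
  refine ⟨σ, fun j y hy => ?_⟩
  set R := (1 + √(r * δ)) ^ 2 with hR
  have hR0 : 0 < R := by positivity
  set v := ∑ i, y i • u i with hv
  set x : Fin r × n → ℂ := fun p => if p.1 = j then v p.2 else 0 with hx
  have hxN : sqNorm x = sqNorm v := by
    rw [sqNorm, Fintype.sum_prod_type, Finset.sum_eq_single j]
    · simp [hx, sqNorm]
    · intro k _ hk; simp [hx, hk]
    · simp
  have hσx := hσ x
  rw [hxN] at hσx
  set z : ι → ℂ := fun i => if σ i = j then star (u i) ⬝ᵥ v else 0 with hz
  have hzN : r * sqNorm z ≤ R * sqNorm v := by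
    refine le_trans (le_of_eq ?_) hσx
    rw [sqNorm, Finset.mul_sum]
    refine Finset.sum_congr rfl fun i _ => ?_
    rw [hwd]
    by_cases hi : σ i = j
    · simp [hz, hx, hi]
    · have : (fun k => x (σ i, k)) = 0 := by ext k; simp [hx, hi]
      simp [hz, hi, this]
  have hvy : (sqNorm v : ℂ) = star z ⬝ᵥ y := by
    rw [← star_dotProduct_self]
    conv_lhs => rw [hv, star_dotProduct_sum_smul, ← hv]
    refine Finset.sum_congr rfl fun i _ => ?_
    by_cases hi : σ i = j
    · simp [hz, hi]
    · simp [hy i hi]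
  -- This weight turns the `z` term into at most `sqNorm v`, which is absorbed on the left.
  have h1 := two_mul_re_dotProduct_le z y (c := r / R) (by positivity)
  rw [← hvy, Complex.ofReal_re, inv_div] at h1
  have h2 : r / R * sqNorm z ≤ sqNorm v := by
    rw [div_mul_eq_mul_div, div_le_iff₀ hR0]; linarith
  linarith

/-- The quadratic form of a complex matrix. -/
noncomputable def quadForm {ι : Type*} [Fintype ι] (A : Matrix ι ι ℂ) (y : ι → ℂ) : ℝ :=
  (star y ⬝ᵥ A *ᵥ y).re

theorem sqNorm_mulVec {ι n : Type*} [Fintype ι] [Fintype n] (B : Matrix n ι ℂ) (y : ι → ℂ) :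
    sqNorm (B *ᵥ y) = quadForm (Bᴴ * B) y := by
  rw [quadForm, ← mulVec_mulVec, dotProduct_mulVec, ← star_mulVec, star_dotProduct_self,
    Complex.ofReal_re]

theorem quadForm_conj {ι : Type*} [Fintype ι] (A E : Matrix ι ι ℂ) (y : ι → ℂ) :
    quadForm (Eᴴ * A * E) y = quadForm A (E *ᵥ y) := by
  rw [quadForm, quadForm, ← mulVec_mulVec, ← mulVec_mulVec, dotProduct_mulVec, ← star_mulVec]

/-- Paving of positive matrices with small diagonal. -/
theorem exists_coloring_of_posSemidef {ι : Type*} [Fintype ι] [DecidableEq ι] {A : Matrix ι ι ℂ}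
    (hA : A.PosSemidef) (h : ∀ y, quadForm A y ≤ sqNorm y) {δ : ℝ} (hδ : 0 < δ)
    (hd : ∀ i, quadForm A (Pi.single i 1) ≤ δ) {r : ℕ} (hr : 0 < r) :
    ∃ σ : ι → Fin r, ∀ j, ∀ y : ι → ℂ, (∀ i, σ i ≠ j → y i = 0) →
      quadForm A y ≤ (1 + √(r * δ)) ^ 2 / r * sqNorm y := by
  obtain ⟨m, B, rfl⟩ : ∃ (m : ℕ) (B : Matrix (Fin m) ι ℂ), A = Bᴴ * B := by
    obtain ⟨m, v, hv⟩ := posSemidef_iff_eq_sum_vecMulVec.1 hA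
    refine ⟨m, of fun k i => star (v k i), ?_⟩
    ext i j
    simp [hv, Matrix.sum_apply, Matrix.mul_apply, vecMulVec_apply]
  have e : ∀ y : ι → ℂ, ∑ i, y i • B.col i = B *ᵥ y := fun y => by
    ext k
    simp [mulVec, dotProduct, Finset.sum_apply, mul_comm]
  obtain ⟨σ, hσ⟩ := exists_coloring_of_vectors (u := B.col)
    (fun y => by rw [e, sqNorm_mulVec]; exact h y) hδ
    (fun i => by rw [← mulVec_single_one, sqNorm_mulVec]; exact hd i) hr
  refine ⟨σ, fun j y hy => ?_⟩
  have := hσ j y hy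
  rwa [e, sqNorm_mulVec] at this

end Paving

/-! ### Lower Riesz bounds by paving twice -/

section Feichtinger

open Matrix
open scoped ComplexOrder

theorem quadForm_add {ι : Type*} [Fintype ι] (A B : Matrix ι ι ℂ) (y : ι → ℂ) :
    quadForm (A + B) y = quadForm A y + quadForm B y := by
  simp [quadForm, add_mulVec]

theorem quadForm_smul {ι : Type*} [Fintype ι] (c : ℝ) (A : Matrix ι ι ℂ) (y : ι → ℂ) :
    quadForm ((c : ℂ) • A) y = c * quadForm A y := by
  simp [quadForm, smul_mulVec]

theorem quadForm_sum {ι κ : Type*} [Fintype ι] (s : Finset κ) (A : κ → Matrix ι ι ℂ)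
    (y : ι → ℂ) : quadForm (∑ j ∈ s, A j) y = ∑ j ∈ s, quadForm (A j) y := by
  simp [quadForm, sum_mulVec, dotProduct_sum]

theorem quadForm_one {ι : Type*} [Fintype ι] [DecidableEq ι] (y : ι → ℂ) :
    quadForm (1 : Matrix ι ι ℂ) y = sqNorm y := by
  rw [quadForm, one_mulVec, star_dotProduct_self, Complex.ofReal_re]

theorem quadForm_one_sub {ι : Type*} [Fintype ι] [DecidableEq ι] (A : Matrix ι ι ℂ) (y : ι → ℂ) :
    quadForm (1 - A) y = sqNorm y - quadForm A y := by
  have := quadForm_add (1 - A) A y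
  rw [sub_add_cancel, quadForm_one] at this
  linarith

theorem quadForm_const_smul {ι : Type*} [Fintype ι] (c : ℂ) (A : Matrix ι ι ℂ) (y : ι → ℂ) :
    quadForm A (c • y) = ‖c‖ ^ 2 * quadForm A y := by
  rw [quadForm, mulVec_smul, dotProduct_smul, star_smul, smul_dotProduct, smul_eq_mul, smul_eq_mul,
    ← mul_assoc, RCLike.star_def, mul_comm c, Complex.conj_mul', ← Complex.ofReal_pow,
    Complex.re_ofReal_mul, quadForm]

theorem quadForm_nonneg {ι : Type*} [Fintype ι] {A : Matrix ι ι ℂ} (hA : A.PosSemidef)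
    (y : ι → ℂ) : 0 ≤ quadForm A y :=
  (Complex.le_def.1 (hA.dotProduct_mulVec_nonneg y)).1

theorem posSemidef_of_quadForm_nonneg {ι : Type*} [Fintype ι] {A : Matrix ι ι ℂ}
    (hA : A.IsHermitian) (h : ∀ y, 0 ≤ quadForm A y) : A.PosSemidef := by
  refine PosSemidef.of_dotProduct_mulVec_nonneg hA fun y => ?_
  have him : (star y ⬝ᵥ A *ᵥ y).im = 0 := by
    apply Complex.conj_eq_iff_im.1
    rw [← RCLike.star_def, ← star_dotProduct_star, star_star, star_mulVec, hA.eq,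
      ← dotProduct_mulVec]
  exact Complex.le_def.2 ⟨h y, by simpa using him.symm⟩

theorem sqNorm_single {ι : Type*} [Fintype ι] [DecidableEq ι] (i : ι) :
    sqNorm (Pi.single i (1 : ℂ)) = 1 := by
  rw [sqNorm, Finset.sum_eq_single i]
  · simp
  · intro k _ hk; simp [hk]
  · simp

theorem sqNorm_le_of_norm_le {ι : Type*} [Fintype ι] {x y : ι → ℂ} (h : ∀ i, ‖x i‖ ≤ ‖y i‖) :
    sqNorm x ≤ sqNorm y :=
  Finset.sum_le_sum fun i _ => pow_le_pow_left₀ (norm_nonneg _) (h i) 2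

/-- Lower Riesz bounds for the pieces of a coloring, in terms of a complementary paving. -/
theorem exists_coloring_lower_bound_of_diag {ι : Type*} [Fintype ι] [DecidableEq ι]
    {A : Matrix ι ι ℂ} (hA : A.PosSemidef) (h : ∀ y, quadForm A y ≤ sqNorm y)
    (hd : ∀ i, 1 / 6 ≤ quadForm A (Pi.single i 1)) :
    ∃ σ : ι → Fin 144, ∀ j, ∀ y : ι → ℂ, (∀ i, σ i ≠ j → y i = 0) →
      1 / 200 * sqNorm y ≤ quadForm A y := by
  have hH : (1 - A).IsHermitian := isHermitian_one.sub hA.isHermitian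
  obtain ⟨σ, hσ⟩ := exists_coloring_of_posSemidef (A := 1 - A)
    (posSemidef_of_quadForm_nonneg hH fun y => by rw [quadForm_one_sub]; linarith [h y])
    (fun y => by rw [quadForm_one_sub]; linarith [quadForm_nonneg hA y])
    (δ := 5 / 6) (by norm_num)
    (fun i => by rw [quadForm_one_sub, sqNorm_single]; linarith [hd i]) (r := 144) (by norm_num)
  refine ⟨σ, fun j y hy => ?_⟩
  have h1 := hσ j y hy
  rw [quadForm_one_sub] at h1
  -- The constant `144` makes `(1 + √(5r/6))² / r` smaller than `1`; the gap `1/200` becomes the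
  -- lower bound.
  have h2 : √(((144 : ℕ) : ℝ) * (5 / 6)) ≤ 10.96 :=
    Real.sqrt_le_iff.2 ⟨by norm_num, by norm_num⟩
  have h3 : (1 + √(((144 : ℕ) : ℝ) * (5 / 6))) ^ 2 / ((144 : ℕ) : ℝ) ≤ 199 / 200 := by
    rw [div_le_iff₀ (by norm_num)]
    have := pow_le_pow_left₀ (by positivity) (add_le_add_right h2 1) 2
    refine this.trans (by norm_num)
  have h4 := mul_le_mul_of_nonneg_right h3 (sqNorm_nonneg y)
  linarith

/-- The contraction `D` makes the diagonal equal to `ε`. The first paving bounds each diagonal block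
by `6ε`; the second is applied once to the block-diagonal matrix `A'`, so the same 144 colours serve
all blocks. The result is `6ε / 200`, which exceeds `ε / 50`. -/
theorem exists_coloring_lower_bound {ι : Type*} [Fintype ι] {A : Matrix ι ι ℂ}
    (hA : A.PosSemidef) (h : ∀ y, quadForm A y ≤ sqNorm y) {ε : ℝ} (hε : 0 < ε)
    (hd : ∀ i, ε ≤ (A i i).re) {r : ℕ} (hr : 1 / ε ≤ r) (hr' : r * ε ≤ 2) :
    ∃ σ : ι → Fin r × Fin 144, ∀ j, ∀ y : ι → ℂ, (∀ i, σ i ≠ j → y i = 0) →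
      ε / 50 * sqNorm y ≤ quadForm A y := by
  classical
  have hr0 : (0 : ℝ) < r := (by positivity : 0 < 1 / ε).trans_le hr
  have hAs : ∀ i, quadForm A (Pi.single i 1) = (A i i).re := fun i => by
    simp [quadForm, Pi.star_single]
  have hpos : ∀ i, 0 < (A i i).re := fun i => hε.trans_le (hd i)
  set d : ι → ℝ := fun i => √(ε / (A i i).re) with hdd
  have hd0 : ∀ i, 0 < d i := fun i => Real.sqrt_pos.2 (div_pos hε (hpos i))
  have hd1 : ∀ i, d i ≤ 1 := fun i => by
    rw [hdd]; simp only
    exact Real.sqrt_le_iff.2 ⟨zero_le_one, by rw [one_pow, div_le_one (hpos i)]; exact hd i⟩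
  have hd2 : ∀ i, d i ^ 2 * (A i i).re = ε := fun i => by
    rw [hdd]; simp only
    rw [Real.sq_sqrt (div_pos hε (hpos i)).le, div_mul_cancel₀ _ (hpos i).ne']
  have hnd : ∀ i, ‖(d i : ℂ)‖ = d i := fun i => by
    rw [Complex.norm_real, Real.norm_of_nonneg (hd0 i).le]
  set D : Matrix ι ι ℂ := diagonal fun i => (d i : ℂ) with hD
  have hDs : ∀ i, quadForm A (D *ᵥ Pi.single i 1) = ε := fun i => by
    have : D *ᵥ Pi.single i 1 = (d i : ℂ) • Pi.single i 1 := by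
      ext k; by_cases hk : k = i
      · subst hk; simp [hD, mulVec_diagonal]
      · simp [hD, mulVec_diagonal, hk]
    rw [this, quadForm_const_smul, hAs, hnd, hd2]
  obtain ⟨σ, hσ⟩ := exists_coloring_of_posSemidef (A := Dᴴ * A * D)
    (hA.conjTranspose_mul_mul_same D)
    (fun y => by
      rw [quadForm_conj]
      refine (h _).trans (sqNorm_le_of_norm_le fun i => ?_)
      rw [hD, mulVec_diagonal, norm_mul, hnd]
      exact mul_le_of_le_one_left (norm_nonneg _) (hd1 i))
    hε (fun i => by rw [quadForm_conj, hDs]) (r := r) (by exact_mod_cast hr0)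
  -- Here `1 ≤ r ε ≤ 2`, so the numerator is at most `(1 + 1.42)² ≤ 6 ≤ 6 r ε`.
  have hbound : (1 + √(r * ε)) ^ 2 / r ≤ 6 * ε := by
    have h1 : √(r * ε) ≤ 1.42 := Real.sqrt_le_iff.2 ⟨by norm_num, hr'.trans (by norm_num)⟩
    have h2 := pow_le_pow_left₀ (by positivity) (add_le_add_right h1 1) 2
    rw [div_le_iff₀ hr0]
    rw [div_le_iff₀ hε] at hr
    have h3 : ((1 : ℝ) + 1.42) ^ 2 ≤ 6 := by norm_num
    linarith
  set E : Fin r → Matrix ι ι ℂ := fun j => diagonal fun i => if σ i = j then (1 : ℂ) else 0 with hE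
  have hEy : ∀ j (y : ι → ℂ) i, (E j *ᵥ y) i = if σ i = j then y i else 0 := fun j y i => by
    simp [hE, mulVec_diagonal]
  have hsplit : ∀ y : ι → ℂ, ∑ j, sqNorm (E j *ᵥ y) = sqNorm y := fun y => by
    simp only [sqNorm, hEy]
    rw [Finset.sum_comm]
    refine Finset.sum_congr rfl fun i _ => ?_
    rw [Finset.sum_eq_single (σ i)]
    · simp
    · intro k _ hk; simp [hk.symm]
    · simp
  set A' : Matrix ι ι ℂ := (((6 * ε)⁻¹ : ℝ) : ℂ) • ∑ j, (E j)ᴴ * (Dᴴ * A * D) * E j with hA'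
  have hA'q : ∀ y, quadForm A' y = (6 * ε)⁻¹ * ∑ j, quadForm A (D *ᵥ (E j *ᵥ y)) := fun y => by
    rw [hA', quadForm_smul, quadForm_sum]
    simp only [quadForm_conj]
  have hA'psd : A'.PosSemidef := by
    refine PosSemidef.smul (posSemidef_sum _ fun j _ =>
      (hA.conjTranspose_mul_mul_same D).conjTranspose_mul_mul_same (E j)) ?_
    exact_mod_cast (by positivity : (0 : ℝ) ≤ (6 * ε)⁻¹)
  obtain ⟨ρ, hρ⟩ := exists_coloring_lower_bound_of_diag hA'psd
    (fun y => by
      rw [hA'q, inv_mul_le_iff₀ (by positivity), ← hsplit y, Finset.mul_sum]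
      refine Finset.sum_le_sum fun j _ => ?_
      rw [← quadForm_conj]
      refine (hσ j _ fun i hi => by rw [hEy, if_neg hi]).trans ?_
      exact mul_le_mul_of_nonneg_right hbound (sqNorm_nonneg _))
    (fun i => by
      rw [hA'q, inv_mul_eq_div, le_div_iff₀ (by positivity)]
      have h1 : E (σ i) *ᵥ Pi.single i 1 = Pi.single i 1 := by
        ext k; rw [hEy]; by_cases hk : k = i
        · subst hk; simp
        · simp [hk]
      refine le_trans (le_of_eq ?_) (Finset.single_le_sum
        (fun j _ => quadForm_nonneg hA _) (Finset.mem_univ (σ i)))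
      rw [h1, hDs]; ring)
  refine ⟨fun i => (σ i, ρ i), fun j y hy => ?_⟩
  -- The scaling is undone at no loss: `d i ≤ 1`, so `x` is at least as long as `y`.
  set x : ι → ℂ := fun i => (d i : ℂ)⁻¹ * y i with hx
  have hDx : D *ᵥ x = y := by
    ext i
    have : (d i : ℂ) ≠ 0 := by exact_mod_cast (hd0 i).ne'
    rw [hD, mulVec_diagonal, hx]; field_simp
  have hyx : sqNorm y ≤ sqNorm x := sqNorm_le_of_norm_le fun i => by
    rw [hx]; simp only
    rw [norm_mul, norm_inv, hnd]
    exact le_mul_of_one_le_left (norm_nonneg _) ((one_le_inv₀ (hd0 i)).2 (hd1 i))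
  have hx1 : ∀ i, σ i ≠ j.1 → x i = 0 := fun i hi => by
    simp [hx, hy i fun h' => hi (congrArg Prod.fst h')]
  have hx2 : ∀ i, ρ i ≠ j.2 → x i = 0 := fun i hi => by
    simp [hx, hy i fun h' => hi (congrArg Prod.snd h')]
  have h1 := hρ j.2 x hx2
  have h2 : ∑ k, quadForm A (D *ᵥ (E k *ᵥ x)) = quadForm A y := by
    rw [Finset.sum_eq_single j.1]
    · have : E j.1 *ᵥ x = x := by
        ext i; rw [hEy]; split_ifs with hi
        · rfl
        · exact (hx1 i hi).symm
      rw [this, hDx]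
    · intro k _ hk
      have : E k *ᵥ x = 0 := by
        ext i; rw [hEy]; split_ifs with hi
        · exact hx1 i (by rw [hi]; exact hk)
        · rfl
      simp [this, quadForm]
    · simp
  rw [hA'q, h2, inv_mul_eq_div, le_div_iff₀ (by positivity)] at h1
  have h3 : 0 ≤ ε * (sqNorm x - sqNorm y) := mul_nonneg hε.le (by linarith)
  have h4 : 0 ≤ ε * sqNorm x := mul_nonneg hε.le (sqNorm_nonneg x)
  linarith

/-! ### Bessel sequences in Hilbert space and passage to infinite families -/

section Hilbert

variable {ι H : Type*} [NormedAddCommGroup H] [InnerProductSpace ℂ H] {u : ι → H}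

/-- Expanding `‖x‖²` as `∑ y i ⟨x, u i⟩` bounds it by half of `∑ ‖y i‖² + ∑ ‖⟨x, u i⟩‖²`, and the
Bessel bound absorbs the last sum into `‖x‖²`. -/
theorem norm_sum_sq_le_of_isBesselSequence (hu : IsBesselSequence u 1) (s : Finset ι)
    (y : ι → ℂ) : ‖∑ i ∈ s, y i • u i‖ ^ 2 ≤ ∑ i ∈ s, ‖y i‖ ^ 2 := by
  set x := ∑ i ∈ s, y i • u i with hx
  obtain ⟨h1, h2⟩ := hu x
  have h3 : ∑ i ∈ s, ‖inner ℂ x (u i)‖ ^ 2 ≤ ‖x‖ ^ 2 := by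
    rw [one_mul] at h2
    exact (h1.sum_le_tsum s fun _ _ => by positivity).trans h2
  have h4 : ‖x‖ ^ 2 ≤ ∑ i ∈ s, ‖y i‖ * ‖inner ℂ x (u i)‖ := by
    have : inner ℂ x x = ∑ i ∈ s, y i * inner ℂ x (u i) := by
      conv_lhs => rw [hx, inner_sum, ← hx]
      simp only [inner_smul_right]
    rw [← inner_self_eq_norm_sq (𝕜 := ℂ), this]
    refine (RCLike.re_le_norm _).trans ((norm_sum_le _ _).trans ?_)
    simp only [norm_mul, le_refl]
  have h5 : ∑ i ∈ s, ‖y i‖ * ‖inner ℂ x (u i)‖ ≤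
      ∑ i ∈ s, (‖y i‖ ^ 2 + ‖inner ℂ x (u i)‖ ^ 2) / 2 :=
    Finset.sum_le_sum fun i _ => by nlinarith [sq_nonneg (‖y i‖ - ‖inner ℂ x (u i)‖)]
  rw [← Finset.sum_div, Finset.sum_add_distrib] at h5
  linarith

theorem quadForm_gram [Fintype ι] (u : ι → H) (y : ι → ℂ) :
    quadForm (gram ℂ u) y = ‖∑ i, y i • u i‖ ^ 2 := by
  rw [quadForm, ← inner_self_eq_norm_sq (𝕜 := ℂ), sum_inner]
  congr 1
  refine Finset.sum_congr rfl fun i _ => ?_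
  rw [inner_smul_left, inner_sum, Pi.star_apply, mulVec, dotProduct]
  congr 1
  refine Finset.sum_congr rfl fun k _ => ?_
  rw [inner_smul_right, gram_apply, mul_comm]

/-- A single coloring of a Bessel sequence with uniform lower Riesz bounds on finite sets. -/
theorem exists_coloring_of_isBesselSequence (hu : IsBesselSequence u 1) {ε : ℝ} (hε : 0 < ε)
    (hd : ∀ i, ε ≤ ‖u i‖ ^ 2) {r : ℕ} (hr : 1 / ε ≤ r) (hr' : r * ε ≤ 2) :
    ∃ χ : ι → Fin r × Fin 144, ∀ j, ∀ s : Finset ι, (∀ i ∈ s, χ i = j) → ∀ y : ι → ℂ,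
      ε / 50 * ∑ i ∈ s, ‖y i‖ ^ 2 ≤ ‖∑ i ∈ s, y i • u i‖ ^ 2 := by
  classical
  have hr0 : (0 : ℝ) < r := (by positivity : 0 < 1 / ε).trans_le hr
  have : Nonempty (Fin r × Fin 144) := ⟨⟨⟨0, by exact_mod_cast hr0⟩, 0⟩⟩
  have hfin : ∀ F : Finset ι, ∃ g : ι → Fin r × Fin 144, ∀ j, ∀ s ⊆ F, (∀ i ∈ s, g i = j) →
      ∀ y : ι → ℂ, ε / 50 * ∑ i ∈ s, ‖y i‖ ^ 2 ≤ ‖∑ i ∈ s, y i • u i‖ ^ 2 := by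
    intro F
    obtain ⟨σ, hσ⟩ := exists_coloring_lower_bound (A := gram ℂ fun i : F => u i)
      (posSemidef_gram ℂ _)
      (fun y => by
        rw [quadForm_gram]
        have h1 := norm_sum_sq_le_of_isBesselSequence hu F
          fun i => if h : i ∈ F then y ⟨i, h⟩ else 0
        rw [← Finset.sum_coe_sort, ← Finset.sum_coe_sort F] at h1
        simpa [sqNorm] using h1)
      hε (fun i => by
        rw [gram_apply, inner_self_eq_norm_sq_to_K]
        refine (hd i).trans (le_of_eq ?_)
        rw [← RCLike.ofReal_pow]
        exact (Complex.ofReal_re _).symm) hr hr'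
    refine ⟨fun i => if h : i ∈ F then σ ⟨i, h⟩ else Classical.arbitrary _, fun j s hs hj y => ?_⟩
    have h1 := hσ j (fun i => if (i : ι) ∈ s then y i else 0) fun i hi => by
      rw [if_neg]
      intro his
      have := hj i his
      simp only [i.2, dif_pos] at this
      exact hi this
    rw [quadForm_gram, sqNorm, Finset.sum_coe_sort F fun i => ‖if i ∈ s then y i else 0‖ ^ 2,
      Finset.sum_coe_sort F fun i => (if i ∈ s then y i else 0) • u i,
      ← Finset.sum_subset hs, ← Finset.sum_subset hs] at h1
    · have e : ∀ i ∈ s, (if i ∈ s then y i else 0) = y i := fun i hi => if_pos hi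
      rwa [Finset.sum_congr rfl fun i hi => by rw [e i hi],
        Finset.sum_congr (g := fun i => y i • u i) rfl fun i hi => by rw [e i hi]] at h1
    · intro i _ hi; simp [hi]
    · intro i _ hi; simp [hi]
  choose g hg using hfin
  -- Compactness: on each finite set `χ` agrees with the colouring `g t` of some larger finite set
  -- `t`, and the lower bounds concern only finite sets.
  obtain ⟨χ, hχ⟩ := Finset.rado_selection (β := fun _ : ι => Fin r × Fin 144) g
  refine ⟨χ, fun j s hs y => ?_⟩
  obtain ⟨t, hst, ht⟩ := hχ s
  exact hg t j s hst (fun i hi => by rw [← ht i hi]; exact hs i hi) y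

/-- The upper bound makes the partial sums Cauchy; both inequalities then pass to the limit. -/
theorem isRieszSequence_of_finite_bounds [CompleteSpace H] {A : ℝ} (hA : 0 < A)
    (hup : ∀ (s : Finset ι) (y : ι → ℂ), ‖∑ i ∈ s, y i • u i‖ ^ 2 ≤ ∑ i ∈ s, ‖y i‖ ^ 2)
    (hlow : ∀ (s : Finset ι) (y : ι → ℂ), A * ∑ i ∈ s, ‖y i‖ ^ 2 ≤ ‖∑ i ∈ s, y i • u i‖ ^ 2) :
    IsRieszSequence u := by
  refine ⟨A, 1, hA, one_pos, fun a ha => ?_⟩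
  have hs : Summable fun i => a i • u i := by
    rw [summable_iff_vanishing_norm] at ha ⊢
    intro δ hδ
    obtain ⟨s, hs⟩ := ha (δ ^ 2) (by positivity)
    refine ⟨s, fun t ht => ?_⟩
    have h1 := hs t ht
    rw [Real.norm_of_nonneg (Finset.sum_nonneg fun _ _ => by positivity)] at h1
    exact lt_of_pow_lt_pow_left₀ 2 hδ.le ((hup t a).trans_lt h1)
  have h1 := (hs.hasSum.norm).pow 2
  have h2 := ha.hasSum
  refine ⟨hs, ?_, ?_⟩
  · exact le_of_tendsto_of_tendsto' (h2.const_mul A) h1 fun s => hlow s a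
  · rw [one_mul]
    exact le_of_tendsto_of_tendsto' h1 h2 fun s => hup s a

end Hilbert

end Feichtinger

end KadisonSinger

open KadisonSinger in
theorem mainTheorem7 :
    ∃ C : ℝ, 0 < C ∧
      ∀ (ι : Type*) [Countable ι]
        (H : Type*) [NormedAddCommGroup H] [InnerProductSpace ℂ H] [CompleteSpace H]
        [TopologicalSpace.SeparableSpace H]
        (u : ι → H) (ε : ℝ), 0 < ε → IsBesselSequence u 1 → (∀ i, ε ≤ ‖u i‖ ^ 2) →
        ∃ (r : ℕ) (J : Fin r → Set ι),
          (r : ℝ) ≤ C / ε ∧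
          Pairwise (fun j k => Disjoint (J j) (J k)) ∧
          (⋃ j, J j) = Set.univ ∧
          ∀ j, IsRieszSequence (fun i : J j => u i) := by
  -- There are `144 r` colours, and `r ε ≤ 2`.
  refine ⟨288, by norm_num, fun ι _ H _ _ _ _ u ε hε hu hd => ?_⟩
  rcases isEmpty_or_nonempty ι with hι | ⟨⟨i₀⟩⟩
  · refine ⟨0, fun _ => ∅, by simp; positivity, fun j => j.elim0, ?_, fun j => j.elim0⟩
    exact Subsingleton.elim _ _
  -- A Bessel sequence with bound `1` has vectors of norm at most `1`. Thus `⌈1/ε⌉ ε ≤ 1 + ε ≤ 2`;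
  -- the empty family, where `ε` may be large, is treated separately.
  have hε1 : ε ≤ 1 := by
    have h1 := norm_sum_sq_le_of_isBesselSequence hu {i₀} fun _ => 1
    simp only [Finset.sum_singleton, one_smul, norm_one, one_pow] at h1
    exact (hd i₀).trans h1
  set r := ⌈1 / ε⌉₊ with hr
  have hr1 : 1 / ε ≤ r := Nat.le_ceil _
  have hr2 : r * ε ≤ 2 := by
    have h1 : (r : ℝ) < 1 / ε + 1 := Nat.ceil_lt_add_one (by positivity)
    have h2 := mul_le_mul_of_nonneg_right h1.le hε.le
    rw [add_mul, one_div_mul_cancel hε.ne'] at h2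
    linarith
  obtain ⟨χ, hχ⟩ := exists_coloring_of_isBesselSequence hu hε hd hr1 hr2
  refine ⟨r * 144, fun k => {i | finProdFinEquiv (χ i) = k}, ?_, ?_, ?_, ?_⟩
  · rw [le_div_iff₀ hε]
    push_cast
    linarith
  · intro j k hjk
    rw [Set.disjoint_left]
    rintro i rfl hk
    exact hjk hk
  · ext i; simp
  · intro k
    have hval : Function.Injective (Subtype.val : {i | finProdFinEquiv (χ i) = k} → ι) :=
      Subtype.val_injective
    refine isRieszSequence_of_finite_bounds (A := ε / 50) (by positivity) (fun s y => ?_)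
      fun s y => ?_
    · have h1 := norm_sum_sq_le_of_isBesselSequence hu (s.map ⟨_, hval⟩)
        (Function.extend Subtype.val y 0)
      rw [Finset.sum_map, Finset.sum_map] at h1
      simpa only [Function.Embedding.coeFn_mk, hval.extend_apply] using h1
    · have h1 := hχ (finProdFinEquiv.symm k) (s.map ⟨_, hval⟩) (fun i hi => by
        obtain ⟨i', -, rfl⟩ := Finset.mem_map.1 hi
        rw [Equiv.eq_symm_apply]
        exact i'.2) (Function.extend Subtype.val y 0)
      rw [Finset.sum_map, Finset.sum_map] at h1
      simpa only [Function.Embedding.coeFn_mk, hval.extend_apply] using h1
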